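/- Let $G=(V,E)$ be an infinite connected simple graph of bounded degree. Attach to the edges independent homogeneous Poisson processes of the same intensity $\lambda>0$, and let $M_{e,k}$ ($e\in E$, $k\ge 0$) be random variables with values in $(0,\tfrac12]$ such that for every edge $e$ almost surely $\sum_{k}M_{e,k}=\infty$ (this covers, for example, a constant $\mu\in(0,\tfrac12]$, in particular $\mu=\tfrac12$, and weights bounded below by a positive constant, and i.i.d. weights). Consider the continuous-time averaging process $(\eta_t(v))_{t\ge 0,\,v\in V}$: at the $k$-th event on the edge $e=\langle u,w\rangle$ (counted from $k=0$), the values at $u$ and $w$ just before the event, $a$ and $b$, are replaced by $(1-\mu)a+\mu b$ and $\mu a+(1-\mu)b$ with $\mu=M_{e,k}$; all other values are left unchanged by this event, and the values change only in this way. Suppose that the initial values $\eta_0(v)$, $v\in V$, are i.i.d. with finite second moment, and that the family $(\eta_0(v))_{v\in V}$ is independent of the Poisson processes and weights taken together. Let $m_1=\mathbb{E}[\eta_0(v)]$. Then for every $v\in V$ the random variable $\eta_t(v)$ has a finite second moment for every $t\ge 0$, and $$\lim_{t\to\infty}\mathbb{E}\big[(\eta_t(v)-m_1)^2\big]=0 .$$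 -/

import Mathlib

open MeasureTheory ProbabilityTheory Filter Topology
open scoped NNReal ENNReal

/-- A (homogeneous, rate `lam`) Poisson process: `N t` is the number of events in `(0, t]`.
It starts at `0`, has almost surely nondecreasing right-continuous paths, independent increments,
and the increment over `(s, t]` has the Poisson law with parameter `lam * (t - s)`. -/
structure IsPoissonProcess {Ω : Type*} [MeasurableSpace Ω] (lam : ℝ≥0) (N : ℝ≥0 → Ω → ℕ)
    (P : Measure Ω) : Prop where
  measurable : ∀ t, Measurable (N t)
  zero : ∀ᵐ ω ∂P, N 0 ω = 0
  mono : ∀ᵐ ω ∂P, Monotone fun t => N t ω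
  rightCont : ∀ᵐ ω ∂P, ∀ t, ContinuousWithinAt (fun s => N s ω) (Set.Ici t) t
  indepIncrements : HasIndepIncrements N P
  law_increment : ∀ s t, s ≤ t →
    HasLaw (fun ω => N t ω - N s ω) (poissonMeasure (lam * (t - s))) P

open Classical in
/-- The profile obtained from `η` by an update to the extent `μ` along the edge `⟨u, w⟩`. -/
noncomputable def averagingUpdate {V : Type*} (μ : ℝ) (u w : V) (η : V → ℝ) : V → ℝ := fun v =>
  if v = u then (1 - μ) * η u + μ * η w
  else if v = w then μ * η u + (1 - μ) * η w
  else η v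

/-- `x : ℝ≥0 → V → ℝ` is a trajectory of the averaging dynamics driven by the edge events counted
by `n` (`n e t` is the number of events on the edge `e` in `(0, t]`), where `m e k` is the extent
of the update caused by the `k`-th event on `e`, `k = 0, 1, 2, …`.

* `stay`: the value at `v` does not change during `(s, t]` if no edge at `v` has an event then;
* `update`: if during `(s, t]` there is exactly one event on the edge `e = ⟨u, w⟩` and no event on
  any other edge at `u` or `w`, then the values at `u` and `w` change as in one update along `e`.

When events at a vertex are isolated and never simultaneous on edges that share a vertex, this
says that each event on `e` replaces the values at its two ends, just before the event, by their
updated values, and that nothing else ever changes. -/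
structure IsAveragingTrajectory {V : Type*} (G : SimpleGraph V) (n : G.edgeSet → ℝ≥0 → ℕ)
    (m : G.edgeSet → ℕ → ℝ) (x : ℝ≥0 → V → ℝ) : Prop where
  stay : ∀ (v : V) (s t : ℝ≥0), s ≤ t →
    (∀ e : G.edgeSet, v ∈ (e : Sym2 V) → n e t = n e s) → x t v = x s v
  update : ∀ (e : G.edgeSet) (u w : V) (s t : ℝ≥0), (e : Sym2 V) = s(u, w) → s ≤ t →
    n e t = n e s + 1 →
    (∀ f : G.edgeSet, f ≠ e → (u ∈ (f : Sym2 V) ∨ w ∈ (f : Sym2 V)) → n f t = n f s) →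
    x t u = averagingUpdate (m e (n e s)) u w (x s) u ∧
      x t w = averagingUpdate (m e (n e s)) u w (x s) w

/-- `η t v ω` is the continuous-time averaging process on `G` with edge clocks `N`, update extents
`M` (`M e k` belongs to the `k`-th event on `e`) and initial profile `η 0`: the clocks are
independent rate-`lam` Poisson processes, the extents are random variables with values in
`(0, 1/2]`, clocks and extents are jointly independent of the initial profile, and almost every
trajectory follows the averaging dynamics. -/
structure IsAveragingProcess {V Ω : Type*} [MeasurableSpace Ω] (G : SimpleGraph V) (lam : ℝ≥0)
    (N : G.edgeSet → ℝ≥0 → Ω → ℕ) (M : G.edgeSet → ℕ → Ω → ℝ) (η : ℝ≥0 → V → Ω → ℝ)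
    (P : Measure Ω) : Prop where
  poisson : ∀ e, IsPoissonProcess lam (N e) P
  indep_clocks : iIndepFun (fun (e : G.edgeSet) (ω : Ω) (t : ℝ≥0) => N e t ω) P
  measurable_extent : ∀ e k, Measurable (M e k)
  extent_mem : ∀ e k, ∀ᵐ ω ∂P, M e k ω ∈ Set.Ioc (0 : ℝ) (1 / 2)
  measurable_value : ∀ t v, Measurable (η t v)
  indep_initial : IndepFun
    (fun (ω : Ω) => ((fun (e : G.edgeSet) (t : ℝ≥0) => N e t ω),
      (fun (e : G.edgeSet) (k : ℕ) => M e k ω)))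
    (fun (ω : Ω) (v : V) => η 0 v ω) P
  trajectory : ∀ᵐ ω ∂P, IsAveragingTrajectory G (fun e t => N e t ω) (fun e k => M e k ω)
    (fun t v => η t v ω)

/-!
The value at `v` at time `t` is a random average `∑ u, ξ u * η 0 u` of the initial values, with
weights `ξ u ≥ 0` of total mass one that depend on the clocks and extents only. Since the initial
values are independent of these and of each other, the variance of the value is the initial
variance times `𝔼 [∑ u, ξ u ^ 2] ≤ 𝔼 [max u, ξ u]` (`integral_sq_sum_mul`), and it remains to see
that no single initial value keeps a noticeable weight.

For fixed `u` the weight of `η 0 u` in the values at all the vertices is itself a profile evolving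
by averaging, started from the indicator of `u`. For this profile there is a deterministic
argument, `exists_windows_decay`, which needs no independence of the extents. The mass above a
level `θ`, called `excess` below, never increases. If a profile of mass one reaches a value `c`,
then by pigeonhole there is a gap of width bounded below somewhere between `c / 2` and `c`,
separating a bounded number of high vertices from all the others. As the extents are at most
`1 / 2`, this set stays the same, and the gap open, until the excess over one of finitely many levels
drops by a fixed amount (`IsAveragingRun.separates_of_excess`). The number of such drops is
bounded, which has two consequences. First, the vertices that ever reach the value `c / 2` are
bounded in number; as they form a connected set containing `u`, both `u` and the high sets stay
within a bounded distance of any vertex `v` where the value is `c` at the end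
(`exists_dist_high_le`). Second, among sufficiently many time windows there is one without a drop;
but a finite set of high vertices has a boundary edge, and if this edge receives a total weight of
at least one during the window, it forces a drop. Hence the weight of `η 0 u` at `v` is below `c`
after boundedly many windows, uniformly in `u`. Since almost surely the extents on each edge sum
up to infinity, such windows can be chosen deterministically, outside an event of small
probability (`IsAveragingProcess.exists_busy_windows`).

An infinite graph has infinitely many events in any time interval, so the weights are constructed
for a fixed time `t` and only up to an event of small probability, on a fine grid of time and
within a large ball. The ball contains everything that can influence the value at `v`, because the
expected exponentially weighted size of the set of influencing vertices stays bounded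
(`IsAveragingProcess.sum_influence_succ_le`), and on a fine grid no two events in the ball share a
piece of time (`IsAveragingProcess.real_not_gridResolves_le`).
-/

/-! ### One averaging step -/

section OneStep

variable {V : Type*}

lemma averagingUpdate_fst (μ : ℝ) (x y : V) (p : V → ℝ) :
    averagingUpdate μ x y p x = (1 - μ) * p x + μ * p y := by
  simp [averagingUpdate]

lemma averagingUpdate_snd {x y : V} (hxy : x ≠ y) (μ : ℝ) (p : V → ℝ) :
    averagingUpdate μ x y p y = μ * p x + (1 - μ) * p y := by
  simp [averagingUpdate, hxy.symm]

lemma averagingUpdate_other {x y z : V} (hx : z ≠ x) (hy : z ≠ y) (μ : ℝ) (p : V → ℝ) :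
    averagingUpdate μ x y p z = p z := by
  simp [averagingUpdate, hx, hy]

lemma averagingUpdate_comm {x y : V} (hxy : x ≠ y) (μ : ℝ) (p : V → ℝ) :
    averagingUpdate μ x y p = averagingUpdate μ y x p := by
  funext z
  by_cases hx : z = x
  · subst hx; rw [averagingUpdate_fst, averagingUpdate_snd hxy.symm]; ring
  by_cases hy : z = y
  · subst hy; rw [averagingUpdate_fst, averagingUpdate_snd hxy]; ring
  rw [averagingUpdate_other hx hy, averagingUpdate_other hy hx]

/-- A sum over a set containing both ends of the edge changes only through these two ends. -/
lemma sum_averagingUpdate_sub {x y : V} (hxy : x ≠ y) {B : Finset V} (hx : x ∈ B) (hy : y ∈ B)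
    (μ : ℝ) (p : V → ℝ) (f : ℝ → ℝ) :
    ∑ z ∈ B, f (averagingUpdate μ x y p z) - ∑ z ∈ B, f (p z) =
      (f ((1 - μ) * p x + μ * p y) - f (p x)) + (f (μ * p x + (1 - μ) * p y) - f (p y)) := by
  classical
  rw [← Finset.sum_sub_distrib, ← averagingUpdate_fst μ x y p, ← averagingUpdate_snd hxy μ p,
    ← Finset.sum_pair (f := fun z => f (averagingUpdate μ x y p z) - f (p z)) hxy]
  symm
  apply Finset.sum_subset
  · intro z hz
    rcases Finset.mem_insert.1 hz with rfl | hz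
    · exact hx
    · rw [Finset.mem_singleton.1 hz]; exact hy
  · intro z _ hz
    simp only [Finset.mem_insert, Finset.mem_singleton, not_or] at hz
    rw [averagingUpdate_other hz.1 hz.2, sub_self]

lemma averagingUpdate_lt {x y : V} (hxy : x ≠ y) {μ : ℝ} (h0 : 0 ≤ μ) (h1 : μ ≤ 1 / 2)
    {p : V → ℝ} {c : ℝ} (h : ∀ z, p z < c) (z : V) : averagingUpdate μ x y p z < c := by
  by_cases hx : z = x
  · subst hx; rw [averagingUpdate_fst]; nlinarith [h z, h y]
  by_cases hy : z = y
  · subst hy; rw [averagingUpdate_snd hxy]; nlinarith [h z, h x]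
  rw [averagingUpdate_other hx hy]; exact h z

lemma averagingUpdate_nonneg {x y : V} (hxy : x ≠ y) {μ : ℝ} (h0 : 0 ≤ μ) (h1 : μ ≤ 1)
    {p : V → ℝ} (h : ∀ z, 0 ≤ p z) (z : V) : 0 ≤ averagingUpdate μ x y p z := by
  by_cases hx : z = x
  · subst hx; rw [averagingUpdate_fst]; nlinarith [h z, h y]
  by_cases hy : z = y
  · subst hy; rw [averagingUpdate_snd hxy]; nlinarith [h z, h x]
  rw [averagingUpdate_other hx hy]; exact h z

/-- The mass of the profile `p` above the level `θ`. It is a convex function of the profile, so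
averaging cannot increase it. -/
noncomputable def excess (B : Finset V) (θ : ℝ) (p : V → ℝ) : ℝ := ∑ z ∈ B, max (p z - θ) 0

lemma excess_nonneg (B : Finset V) (θ : ℝ) (p : V → ℝ) : 0 ≤ excess B θ p :=
  Finset.sum_nonneg fun _ _ => le_max_right _ _

lemma excess_averagingUpdate_le {x y : V} (hxy : x ≠ y) {B : Finset V} (hx : x ∈ B) (hy : y ∈ B)
    {μ : ℝ} (h0 : 0 ≤ μ) (h1 : μ ≤ 1) (θ : ℝ) (p : V → ℝ) :
    excess B θ (averagingUpdate μ x y p) ≤ excess B θ p := by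
  have h := sum_averagingUpdate_sub hxy hx hy μ p (fun r => max (r - θ) 0)
  have e1 : max ((1 - μ) * p x + μ * p y - θ) 0 ≤
      (1 - μ) * max (p x - θ) 0 + μ * max (p y - θ) 0 := by
    apply max_le
    · nlinarith [le_max_left (p x - θ) 0, le_max_left (p y - θ) 0]
    · nlinarith [le_max_right (p x - θ) 0, le_max_right (p y - θ) 0]
  have e2 : max (μ * p x + (1 - μ) * p y - θ) 0 ≤
      μ * max (p x - θ) 0 + (1 - μ) * max (p y - θ) 0 := by
    apply max_le
    · nlinarith [le_max_left (p x - θ) 0, le_max_left (p y - θ) 0]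
    · nlinarith [le_max_right (p x - θ) 0, le_max_right (p y - θ) 0]
  unfold excess
  linarith

/-- The profile `p` exceeds the level `θ` by at least `d` on `A`, and stays at least `d` below it
off `A`. -/
def Separates (θ d : ℝ) (A : Finset V) (p : V → ℝ) : Prop :=
  (∀ z ∈ A, θ + d ≤ p z) ∧ ∀ z ∉ A, p z ≤ θ - d

lemma sum_sub_le_excess {A B : Finset V} (hAB : A ⊆ B) (θ : ℝ) (p : V → ℝ) :
    ∑ z ∈ A, p z - A.card * θ ≤ excess B θ p := by
  have h1 : ∑ z ∈ A, p z - A.card * θ = ∑ z ∈ A, (p z - θ) := by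
    simp [Finset.sum_sub_distrib]
  rw [h1]
  refine le_trans (Finset.sum_le_sum fun z _ => le_max_left (p z - θ) 0) ?_
  exact Finset.sum_le_sum_of_subset_of_nonneg hAB fun _ _ _ => le_max_right _ _

/-- For `d ≥ 0` the excess over any level in the gap is attained on the separated set. -/
lemma Separates.excess_eq {θ d : ℝ} {A B : Finset V} {p : V → ℝ} (h : Separates θ d A p)
    (hAB : A ⊆ B) {θ' : ℝ} (h1 : θ - d ≤ θ') (h2 : θ' ≤ θ + d) :
    excess B θ' p = ∑ z ∈ A, p z - A.card * θ' := by
  have h3 : ∑ z ∈ A, p z - A.card * θ' = ∑ z ∈ A, (p z - θ') := by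
    simp [Finset.sum_sub_distrib]
  rw [h3, excess, ← Finset.sum_subset hAB]
  · exact Finset.sum_congr rfl fun z hz => max_eq_left (by linarith [h.1 z hz])
  · intro z _ hz
    exact max_eq_right (by linarith [h.2 z hz])

/-- An averaging step either lowers the excess over a separating level by the width of the gap, or
the excess after the step is still computed by the sum over the separated set. -/
lemma Separates.excess_averagingUpdate {θ d : ℝ} (hd : 0 ≤ d) {A B : Finset V} {p : V → ℝ}
    (h : Separates θ d A p) (hAB : A ⊆ B) {x y : V} (hxy : x ≠ y) (hx : x ∈ B) (hy : y ∈ B)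
    {μ : ℝ} (h0 : 0 ≤ μ) (h1 : μ ≤ 1 / 2) :
    excess B θ (averagingUpdate μ x y p) ≤ excess B θ p - d ∨
      excess B θ (averagingUpdate μ x y p) =
        ∑ z ∈ A, averagingUpdate μ x y p z - A.card * θ := by
  -- the only interesting case is an edge leaving `A`
  have cross : ∀ x y : V, x ≠ y → x ∈ B → y ∈ B → x ∈ A → y ∉ A →
      excess B θ (averagingUpdate μ x y p) ≤ excess B θ p - d ∨
      excess B θ (averagingUpdate μ x y p) =
        ∑ z ∈ A, averagingUpdate μ x y p z - A.card * θ := by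
    intro x y hxy hx hy hxA hyA
    have hpx := h.1 x hxA
    have hpy := h.2 y hyA
    have e := sum_averagingUpdate_sub hxy hx hy μ p (fun r => max (r - θ) 0)
    have e0 := h.excess_eq hAB (θ' := θ) (by linarith) (by linarith)
    have hsum : ∑ z ∈ A, averagingUpdate μ x y p z =
        ∑ z ∈ A, p z + ((1 - μ) * p x + μ * p y - p x) := by
      classical
      have : ∑ z ∈ A, (averagingUpdate μ x y p z - p z) =
          averagingUpdate μ x y p x - p x := by
        apply Finset.sum_eq_single_of_mem x hxA
        intro z hz hzx
        have hzy : z ≠ y := fun hh => hyA (hh ▸ hz)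
        rw [averagingUpdate_other hzx hzy, sub_self]
      rw [Finset.sum_sub_distrib, averagingUpdate_fst] at this
      linarith
    have m1 : max (p x - θ) 0 = p x - θ := max_eq_left (by linarith)
    have m2 : max (p y - θ) 0 = 0 := max_eq_right (by linarith)
    have hord : μ * p x + (1 - μ) * p y ≤ (1 - μ) * p x + μ * p y := by nlinarith
    simp only [m1, m2] at e
    unfold excess at e0 ⊢
    rcases le_total θ ((1 - μ) * p x + μ * p y) with hqx | hqx
    · rcases le_total θ (μ * p x + (1 - μ) * p y) with hqy | hqy
      · left
        rw [max_eq_left (by linarith), max_eq_left (by linarith)] at e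
        linarith
      · right
        rw [max_eq_left (by linarith), max_eq_right (by linarith)] at e
        linarith
    · left
      rw [max_eq_right (by linarith), max_eq_right (by linarith)] at e
      linarith
  by_cases hxA : x ∈ A <;> by_cases hyA : y ∈ A
  · right
    have hs : Separates θ 0 A (averagingUpdate μ x y p) := by
      constructor
      · intro z hz
        by_cases hzx : z = x
        · subst hzx; rw [averagingUpdate_fst]; nlinarith [h.1 z hz, h.1 y hyA]
        by_cases hzy : z = y
        · subst hzy; rw [averagingUpdate_snd hxy]; nlinarith [h.1 z hz, h.1 x hxA]
        rw [averagingUpdate_other hzx hzy]; linarith [h.1 z hz]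
      · intro z hz
        rw [averagingUpdate_other (ne_of_mem_of_not_mem hxA hz).symm
          (ne_of_mem_of_not_mem hyA hz).symm]
        linarith [h.2 z hz]
    exact hs.excess_eq hAB (by linarith) (by linarith)
  · exact cross x y hxy hx hy hxA hyA
  · rw [averagingUpdate_comm hxy]
    exact cross y x hxy.symm hy hx hyA hxA
  · right
    have hs : Separates θ 0 A (averagingUpdate μ x y p) := by
      constructor
      · intro z hz
        rw [averagingUpdate_other (ne_of_mem_of_not_mem hz hxA) (ne_of_mem_of_not_mem hz hyA)]
        linarith [h.1 z hz]
      · intro z hz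
        by_cases hzx : z = x
        · subst hzx; rw [averagingUpdate_fst]; nlinarith [h.2 z hz, h.2 y hyA]
        by_cases hzy : z = y
        · subst hzy; rw [averagingUpdate_snd hxy]; nlinarith [h.2 z hz, h.2 x hxA]
        rw [averagingUpdate_other hzx hzy]; linarith [h.2 z hz]
    exact hs.excess_eq hAB (by linarith) (by linarith)

end OneStep

/-! ### Sequences of averaging steps -/

section Runs

variable {V : Type*} {G : SimpleGraph V}

/-- A sequence `p 0, p 1, …` of nonnegative profiles of mass at most one supported in `B`, in which
every step either changes nothing or averages along a single edge inside `B`. The weight used on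
the edge `e` in step `i` is `w i e`; it vanishes on the edges that are not updated. -/
structure IsAveragingRun (G : SimpleGraph V) (B : Finset V) (w : ℕ → G.edgeSet → ℝ)
    (p : ℕ → V → ℝ) : Prop where
  nonneg_zero : ∀ x, 0 ≤ p 0 x
  support_zero : ∀ x, x ∉ B → p 0 x = 0
  mass_zero : ∑ x ∈ B, p 0 x ≤ 1
  step : ∀ i, ((∀ e, w i e = 0) ∧ p (i + 1) = p i) ∨
    ∃ (e : G.edgeSet) (x y : V), (e : Sym2 V) = s(x, y) ∧ x ≠ y ∧ x ∈ B ∧ y ∈ B ∧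
      0 ≤ w i e ∧ w i e ≤ 1 / 2 ∧ (∀ f, f ≠ e → w i f = 0) ∧
      p (i + 1) = averagingUpdate (w i e) x y (p i)

namespace IsAveragingRun

variable {B : Finset V} {w : ℕ → G.edgeSet → ℝ} {p : ℕ → V → ℝ}

lemma nonneg (h : IsAveragingRun G B w p) (i : ℕ) (x : V) : 0 ≤ p i x := by
  induction i generalizing x with
  | zero => exact h.nonneg_zero x
  | succ i ih =>
    rcases h.step i with ⟨_, h1⟩ | ⟨f, x', y, _, hxy, _, _, h0, h1, _, h3⟩
    · rw [h1]; exact ih x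
    · rw [h3]; exact averagingUpdate_nonneg hxy h0 (by linarith) ih x

lemma support (h : IsAveragingRun G B w p) (i : ℕ) {x : V} (hx : x ∉ B) : p i x = 0 := by
  induction i with
  | zero => exact h.support_zero x hx
  | succ i ih =>
    rcases h.step i with ⟨_, h1⟩ | ⟨f, x', y, _, hxy, hx', hy', h0, h1, _, h3⟩
    · rw [h1]; exact ih
    · rw [h3, averagingUpdate_other (ne_of_mem_of_not_mem hx' hx).symm
        (ne_of_mem_of_not_mem hy' hx).symm]
      exact ih

lemma mass (h : IsAveragingRun G B w p) (i : ℕ) : ∑ x ∈ B, p i x ≤ 1 := by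
  induction i with
  | zero => exact h.mass_zero
  | succ i ih =>
    rcases h.step i with ⟨_, h1⟩ | ⟨f, x', y, _, hxy, hx', hy', h0, h1, _, h3⟩
    · rw [h1]; exact ih
    · have := sum_averagingUpdate_sub hxy hx' hy' (w i f) (p i) id
      simp only [id] at this
      rw [h3]; linarith

lemma excess_succ_le (h : IsAveragingRun G B w p) (θ : ℝ) (i : ℕ) :
    excess B θ (p (i + 1)) ≤ excess B θ (p i) := by
  rcases h.step i with ⟨_, h1⟩ | ⟨f, x', y, _, hxy, hx', hy', h0, h1, _, h3⟩
  · rw [h1]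
  · rw [h3]; exact excess_averagingUpdate_le hxy hx' hy' h0 (by linarith) θ _

lemma excess_anti (h : IsAveragingRun G B w p) (θ : ℝ) : Antitone fun i => excess B θ (p i) :=
  antitone_nat_of_succ_le (h.excess_succ_le θ)

lemma lt_of_forall_lt (h : IsAveragingRun G B w p) {c : ℝ} {s : ℕ} (hs : ∀ x, p s x < c) {r : ℕ}
    (hr : s ≤ r) (x : V) : p r x < c := by
  induction r, hr using Nat.le_induction generalizing x with
  | base => exact hs x
  | succ r _ ih =>
    rcases h.step r with ⟨_, h1⟩ | ⟨f, x', y, _, hxy, hx', hy', h0, h1, _, h3⟩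
    · rw [h1]; exact ih x
    · rw [h3]; exact averagingUpdate_lt hxy h0 h1 ih x

lemma excess_le_one (h : IsAveragingRun G B w p) {θ : ℝ} (hθ : 0 ≤ θ) (i : ℕ) :
    excess B θ (p i) ≤ 1 := by
  refine le_trans (Finset.sum_le_sum fun z _ => ?_) (h.mass i)
  exact max_le (by linarith) (h.nonneg i z)

/-- As long as the excess over the middle of a gap does not drop by a quarter of the gap's half
width, the gap persists, and it separates the same set of vertices. The excesses over the two ends
of the gap, which do not increase, keep the values off `A` low and those on `A` high. -/
lemma separates_of_excess (h : IsAveragingRun G B w p) {θ δ : ℝ} (hδ : 0 < δ) {A : Finset V}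
    (hAB : A ⊆ B) {s t : ℕ} (hsep : Separates θ δ A (p s))
    (hdrop : excess B θ (p s) - δ / 4 < excess B θ (p t)) {r : ℕ} (hsr : s ≤ r) (hrt : r ≤ t) :
    Separates θ (3 * δ / 4) A (p r) := by
  classical
  induction r, hsr using Nat.le_induction with
  | base =>
    exact ⟨fun z hz => by linarith [hsep.1 z hz], fun z hz => by linarith [hsep.2 z hz]⟩
  | succ r hsr ih =>
    have ih := ih (by omega)
    have hA : ∑ z ∈ A, p s z - δ / 4 < ∑ z ∈ A, p (r + 1) z := by
      have h1 : excess B θ (p t) ≤ excess B θ (p (r + 1)) := h.excess_anti θ hrt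
      have h2 : excess B θ (p r) ≤ excess B θ (p s) := h.excess_anti θ hsr
      have h4 := hsep.excess_eq hAB (θ' := θ) (by linarith) (by linarith)
      have h3 : excess B θ (p (r + 1)) ≤ excess B θ (p r) - 3 * δ / 4 ∨
          excess B θ (p (r + 1)) = ∑ z ∈ A, p (r + 1) z - A.card * θ := by
        rcases h.step r with ⟨_, h1⟩ | ⟨f, x', y, _, hxy, hx', hy', h0, h1, _, h3⟩
        · right
          rw [h1]
          exact ih.excess_eq hAB (by linarith) (by linarith)
        · rw [h3]
          exact ih.excess_averagingUpdate (by linarith) hAB hxy hx' hy' h0 h1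
      rcases h3 with h3 | h3 <;> linarith
    constructor
    · intro z hz
      have h1 : excess B (θ + δ) (p (r + 1)) ≤ excess B (θ + δ) (p s) :=
        h.excess_anti _ (by omega)
      have h2 := sum_sub_le_excess ((Finset.erase_subset z A).trans hAB) (θ + δ) (p (r + 1))
      rw [hsep.excess_eq hAB (by linarith) le_rfl] at h1
      have h3 := Finset.add_sum_erase A (p (r + 1)) hz
      have h4 : ((A.erase z).card : ℝ) = A.card - 1 := by
        rw [Finset.card_erase_of_mem hz, Nat.cast_pred (Finset.card_pos.2 ⟨z, hz⟩)]
      rw [h4] at h2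
      linarith
    · intro z hz
      by_cases hzB : z ∈ B
      · have h1 : excess B (θ - δ) (p (r + 1)) ≤ excess B (θ - δ) (p s) :=
          h.excess_anti _ (by omega)
        have h2 := sum_sub_le_excess (Finset.insert_subset hzB hAB) (θ - δ) (p (r + 1))
        rw [hsep.excess_eq hAB le_rfl (by linarith)] at h1
        rw [Finset.sum_insert hz, Finset.card_insert_of_notMem hz] at h2
        push_cast at h2
        linarith
      · have h1 := hsep.2 z hz
        rw [h.support s hzB] at h1
        rw [h.support _ hzB]
        linarith

/-- While a gap persists, an update of weight `w` on an edge leaving the separated set lowers the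
excess over the gap by at least `w` times the width of the gap. -/
lemma weight_mul_le_excess_sub (h : IsAveragingRun G B w p) {θ d : ℝ} (hd : 0 ≤ d) {A : Finset V}
    (hAB : A ⊆ B) {r : ℕ} (h0 : Separates θ d A (p r)) (h1 : Separates θ d A (p (r + 1)))
    {e : G.edgeSet} {a b : V} (he : (e : Sym2 V) = s(a, b)) (ha : a ∈ A) (hb : b ∉ A) :
    w r e * (2 * d) ≤ excess B θ (p r) - excess B θ (p (r + 1)) := by
  rcases h.step r with ⟨h2, h3⟩ | ⟨f, x, y, hf, hxy, hx, hy, w0, w1, h2, h3⟩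
  · rw [h2, h3]; simp
  · by_cases hef : e = f
    · subst hef
      have hab : a ≠ b := ne_of_mem_of_not_mem ha hb
      have hup : p (r + 1) = averagingUpdate (w r e) a b (p r) := by
        rw [he, Sym2.eq_iff] at hf
        rcases hf with ⟨rfl, rfl⟩ | ⟨rfl, rfl⟩
        · exact h3
        · rw [h3, averagingUpdate_comm hxy]
      rw [h0.excess_eq hAB (θ' := θ) (by linarith) (by linarith),
        h1.excess_eq hAB (θ' := θ) (by linarith) (by linarith)]
      have hsum : ∑ z ∈ A, (p (r + 1) z - p r z) = p (r + 1) a - p r a := by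
        apply Finset.sum_eq_single_of_mem a ha
        intro z hz hza
        rw [hup, averagingUpdate_other hza (ne_of_mem_of_not_mem hz hb), sub_self]
      rw [Finset.sum_sub_distrib, hup, averagingUpdate_fst] at hsum
      rw [hup]
      nlinarith [h0.1 a ha, h0.2 b hb]
    · rw [h2 e hef]
      have := h.excess_succ_le θ r
      linarith

end IsAveragingRun

end Runs

/-! ### High values stay within a bounded set, and eventually disappear -/

section Decay

variable {V : Type*} {G : SimpleGraph V}

/-- Half the width of the gaps that are found between `c / 2` and `c` when at most `K` values
exceed `c / 2`. -/
noncomputable def gapWidth (c : ℝ) (K : ℕ) : ℝ := c / (4 * (K + 1))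

/-- The midpoints of the `K + 1` intervals of length `2 * gapWidth c K` that fill
`[c / 2, c)`. -/
noncomputable def gapLevel (c : ℝ) (K i : ℕ) : ℝ := c / 2 + (2 * i + 1) * gapWidth c K

lemma gapWidth_pos {c : ℝ} (hc : 0 < c) (K : ℕ) : 0 < gapWidth c K := by
  unfold gapWidth; positivity

lemma gapLevel_add_le {c : ℝ} (hc : 0 < c) {K i : ℕ} (hi : i ≤ K) :
    gapLevel c K i + gapWidth c K ≤ c := by
  have h1 : 2 * ((K : ℝ) + 1) * gapWidth c K = c / 2 := by
    unfold gapWidth; field_simp; norm_num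
  have h2 : (i : ℝ) ≤ K := by exact_mod_cast hi
  have h3 := gapWidth_pos hc K
  unfold gapLevel
  nlinarith

lemma le_gapLevel_sub {c : ℝ} (hc : 0 < c) (K i : ℕ) :
    c / 2 ≤ gapLevel c K i - gapWidth c K := by
  have h3 := gapWidth_pos hc K
  unfold gapLevel
  nlinarith [mul_nonneg (Nat.cast_nonneg (α := ℝ) i) h3.le]

/-- Pigeonhole: at most `K` values reach `c / 2`, so one of the `K + 1` intervals contains none. -/
lemma exists_separates {B : Finset V} {p : V → ℝ} (h0 : ∀ x, 0 ≤ p x) (hB : ∀ x ∉ B, p x = 0)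
    (h1 : ∑ x ∈ B, p x ≤ 1) {c : ℝ} (hc : 0 < c) {K : ℕ} (hK : 1 ≤ K * (c / 2)) :
    ∃ i ≤ K, ∃ A ⊆ B, A.card ≤ K ∧ (∀ x ∈ A, c / 2 ≤ p x) ∧
      Separates (gapLevel c K i) (gapWidth c K) A p := by
  classical
  have hδ := gapWidth_pos hc K
  set δ := gapWidth c K with hδdef
  set S := B.filter fun x => c / 2 ≤ p x with hS
  have hcard : S.card ≤ K := by
    have h2 : S.card * (c / 2) ≤ ∑ x ∈ S, p x := by
      rw [← nsmul_eq_mul]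
      exact Finset.card_nsmul_le_sum _ _ _ fun x hx => (Finset.mem_filter.1 hx).2
    have h3 : ∑ x ∈ S, p x ≤ ∑ x ∈ B, p x :=
      Finset.sum_le_sum_of_subset_of_nonneg (Finset.filter_subset _ _) fun x _ _ => h0 x
    have h4 : (S.card : ℝ) * (c / 2) ≤ K * (c / 2) := by linarith
    exact_mod_cast le_of_mul_le_mul_right h4 (by linarith)
  obtain ⟨i, hi, hgap⟩ : ∃ i ≤ K, ∀ x ∈ S,
      ¬ (gapLevel c K i - δ ≤ p x ∧ p x < gapLevel c K i + δ) := by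
    by_contra! hcon
    have : Nonempty V := ⟨(hcon 0 (Nat.zero_le K)).choose⟩
    choose! f hfS hf1 hf2 using hcon
    have hle : (Finset.range (K + 1)).card ≤ S.card := by
      refine Finset.card_le_card_of_injOn f
        (fun i hi => hfS i (Nat.lt_succ_iff.1 (Finset.mem_range.1 hi))) ?_
      have key : ∀ i j, i ≤ K → j ≤ K → f i = f j → ¬ i < j := by
        intro i j hi hj hij hlt
        have e1 := hf2 i hi
        have e2 := hf1 j hj
        rw [← hij] at e2
        have e3 : (i : ℝ) + 1 ≤ j := by exact_mod_cast hlt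
        unfold gapLevel at e1 e2
        rw [← hδdef] at e1 e2
        nlinarith
      intro i hi j hj hij
      have hi' := Nat.lt_succ_iff.1 (Finset.mem_range.1 hi)
      have hj' := Nat.lt_succ_iff.1 (Finset.mem_range.1 hj)
      rcases lt_trichotomy i j with hlt | heq | hlt
      · exact absurd hlt (key i j hi' hj' hij)
      · exact heq
      · exact absurd hlt (key j i hj' hi' hij.symm)
    rw [Finset.card_range] at hle
    omega
  have hlow := le_gapLevel_sub hc K i
  rw [← hδdef] at hlow
  refine ⟨i, hi, S.filter fun x => gapLevel c K i + δ ≤ p x,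
    (Finset.filter_subset _ _).trans (Finset.filter_subset _ _),
    (Finset.card_le_card (Finset.filter_subset _ _)).trans hcard, ?_, ?_, ?_⟩
  · intro x hx
    exact (Finset.mem_filter.1 (Finset.mem_filter.1 hx).1).2
  · intro x hx
    exact (Finset.mem_filter.1 hx).2
  · intro x hx
    by_cases hxS : x ∈ S
    · have h2 := hgap x hxS
      have h3 : ¬ gapLevel c K i + δ ≤ p x := fun h => hx (Finset.mem_filter.2 ⟨hxS, h⟩)
      by_contra! h4
      exact h2 ⟨h4.le, not_le.1 h3⟩
    · by_cases hxB : x ∈ B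
      · have h2 : ¬ c / 2 ≤ p x := fun h => hxS (Finset.mem_filter.2 ⟨hxB, h⟩)
        linarith
      · rw [hB x hxB]
        linarith

/-- The total excess over all midpoints: the potential whose drops are counted. -/
noncomputable def totalExcess (B : Finset V) (c : ℝ) (K : ℕ) (p : V → ℝ) : ℝ :=
  ∑ i ∈ Finset.range (K + 1), excess B (gapLevel c K i) p

lemma totalExcess_nonneg (B : Finset V) (c : ℝ) (K : ℕ) (p : V → ℝ) :
    0 ≤ totalExcess B c K p :=
  Finset.sum_nonneg fun _ _ => excess_nonneg _ _ _

namespace IsAveragingRun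

variable {B : Finset V} {w : ℕ → G.edgeSet → ℝ} {p : ℕ → V → ℝ}

lemma totalExcess_anti (h : IsAveragingRun G B w p) (c : ℝ) (K : ℕ) :
    Antitone fun i => totalExcess B c K (p i) :=
  fun _ _ hij => Finset.sum_le_sum fun _ _ => h.excess_anti _ hij

lemma totalExcess_le (h : IsAveragingRun G B w p) {c : ℝ} (hc : 0 < c) (K i : ℕ) :
    totalExcess B c K (p i) ≤ K + 1 := by
  unfold totalExcess
  refine (Finset.sum_le_card_nsmul _ _ 1 fun j _ => h.excess_le_one ?_ i).trans (by simp)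
  have h1 := gapWidth_pos hc K
  have h2 := le_gapLevel_sub hc K j
  linarith

/-- The drop of a single excess is at most the drop of the total excess. -/
lemma excess_sub_le (h : IsAveragingRun G B w p) (c : ℝ) {K i : ℕ} (hi : i ≤ K) {s t : ℕ}
    (hst : s ≤ t) :
    excess B (gapLevel c K i) (p s) - excess B (gapLevel c K i) (p t) ≤
      totalExcess B c K (p s) - totalExcess B c K (p t) := by
  unfold totalExcess
  rw [← Finset.sum_sub_distrib]
  exact Finset.single_le_sum
    (f := fun i => excess B (gapLevel c K i) (p s) - excess B (gapLevel c K i) (p t))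
    (fun j _ => sub_nonneg.2 (h.excess_anti _ hst)) (Finset.mem_range.2 (by omega))

/-- From any time on, a fixed set of at most `K` vertices is separated from the others by a gap
between `c / 2` and `c`, for as long as the total excess has not dropped. -/
lemma exists_separates_of_totalExcess (h : IsAveragingRun G B w p) {c : ℝ} (hc : 0 < c) {K : ℕ}
    (hK : 1 ≤ K * (c / 2)) (s : ℕ) :
    ∃ i ≤ K, ∃ A ⊆ B, A.card ≤ K ∧ (∀ x ∈ A, c / 2 ≤ p s x) ∧
      ∀ t, s ≤ t → totalExcess B c K (p s) - gapWidth c K / 4 < totalExcess B c K (p t) →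
        Separates (gapLevel c K i) (3 * gapWidth c K / 4) A (p t) := by
  obtain ⟨i, hi, A, hAB, hA, hAc, hsep⟩ :=
    exists_separates (h.nonneg s) (fun x hx => h.support s hx) (h.mass s) hc hK
  refine ⟨i, hi, A, hAB, hA, hAc, fun t hst ht => ?_⟩
  refine h.separates_of_excess (gapWidth_pos hc K) hAB hsep ?_ hst le_rfl
  have := h.excess_sub_le c hi hst
  linarith

lemma mem_of_separates {c : ℝ} (hc : 0 < c) {K i : ℕ} (hi : i ≤ K) {A : Finset V} {q : V → ℝ}
    (hsep : Separates (gapLevel c K i) (3 * gapWidth c K / 4) A q) {x : V} (hx : c ≤ q x) :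
    x ∈ A := by
  by_contra hxA
  have h1 := hsep.2 x hxA
  have h2 := gapLevel_add_le hc hi
  have h3 := gapWidth_pos hc K
  linarith

/-- Induction on the number `n` of drops of the total excess that are still possible: until the next
drop the high vertices lie in a fixed set of at most `K` vertices. -/
lemma exists_card_high_le_of_totalExcess_lt (h : IsAveragingRun G B w p) {c : ℝ}
    (hc : 0 < c) {K : ℕ}
    (hK : 1 ≤ K * (c / 2)) (n s : ℕ) (hn : totalExcess B c K (p s) < n * (gapWidth c K / 4)) :
    ∃ L : Finset V, L.card ≤ n * K ∧ ∀ r, s ≤ r → ∀ x, c ≤ p r x → x ∈ L := by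
  classical
  induction n generalizing s with
  | zero =>
    have := totalExcess_nonneg B c K (p s)
    simp at hn
    linarith
  | succ n ih =>
    obtain ⟨i, hi, A, hAB, hA, hAc, hsep⟩ := h.exists_separates_of_totalExcess hc hK s
    by_cases hex : ∃ r, s ≤ r ∧ totalExcess B c K (p r) ≤ totalExcess B c K (p s) - gapWidth c K / 4
    · have hr0 := Nat.find_spec hex
      have hmin := fun m => Nat.find_min (H := hex) (m := m)
      set r0 := Nat.find hex
      obtain ⟨L, hL, hLr⟩ := ih r0 (by push_cast at hn; linarith)
      refine ⟨A ∪ L, (Finset.card_union_le _ _).trans (by rw [add_mul, one_mul]; omega), ?_⟩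
      intro r hr x hx
      rcases lt_or_ge r r0 with hlt | hge
      · have h1 := hmin r hlt
        simp only [not_and, not_le] at h1
        exact Finset.mem_union_left _ (mem_of_separates hc hi (hsep r hr (h1 hr)) hx)
      · exact Finset.mem_union_right _ (hLr r hge x hx)
    · push Not at hex
      refine ⟨A, by rw [add_mul, one_mul]; omega, fun r hr x hx => ?_⟩
      exact mem_of_separates hc hi (hsep r hr (hex r hr)) hx

end IsAveragingRun

/-- The number of vertices at which a run ever reaches the value `c` is bounded in terms of `c`
alone: the separated set changes only when the total excess drops. -/
lemma exists_card_high_le (G : SimpleGraph V) {c : ℝ} (hc : 0 < c) :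
    ∃ g : ℕ, ∀ (B : Finset V) (w : ℕ → G.edgeSet → ℝ) (p : ℕ → V → ℝ), IsAveragingRun G B w p →
      ∃ L : Finset V, L.card ≤ g ∧ ∀ r x, c ≤ p r x → x ∈ L := by
  obtain ⟨K, hK⟩ := exists_nat_ge (1 / (c / 2))
  have hK' : 1 ≤ K * (c / 2) := (div_le_iff₀ (by linarith)).1 hK
  have hδ := gapWidth_pos hc K
  obtain ⟨n, hn⟩ := exists_nat_gt ((K + 1) / (gapWidth c K / 4))
  rw [div_lt_iff₀ (by linarith)] at hn
  refine ⟨n * K, fun B w p h => ?_⟩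
  obtain ⟨L, hL, hr⟩ := h.exists_card_high_le_of_totalExcess_lt hc hK' n 0
    ((h.totalExcess_le hc K 0).trans_lt hn)
  exact ⟨L, hL, fun r x hx => hr r (Nat.zero_le _) x hx⟩

/-- A run started from a single vertex reaches the value `c` only within a bounded distance: the
vertices where it does so form a connected set, since averaging with a partner raises a value to
`c` only if the partner's value is at least `c`. -/
lemma exists_dist_high_le (hconn : G.Connected) {c : ℝ} (hc : 0 < c) :
    ∃ g : ℕ, ∀ (B : Finset V) (w : ℕ → G.edgeSet → ℝ) (p : ℕ → V → ℝ) (u : V),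
      IsAveragingRun G B w p → (∀ x, x ≠ u → p 0 x = 0) →
      ∀ r x, c ≤ p r x → G.dist u x ≤ g := by
  obtain ⟨g, hg⟩ := exists_card_high_le G hc
  refine ⟨g, fun B w p u h hu => ?_⟩
  obtain ⟨L, hL, hLmem⟩ := hg B w p h
  have key : ∀ r x, c ≤ p r x → ∀ j ≤ G.dist u x, ∃ y ∈ L, G.dist u y = j := by
    intro r
    induction r with
    | zero =>
      intro x hx j hj
      have hxu : x = u := by
        by_contra hne
        rw [hu x hne] at hx
        linarith
      refine ⟨x, hLmem 0 x hx, ?_⟩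
      rw [hxu, SimpleGraph.dist_self] at hj ⊢
      omega
    | succ r ih =>
      intro x hx j hj
      by_cases hxr : c ≤ p r x
      · exact ih x hxr j hj
      · have partner : ∃ y, G.Adj y x ∧ c ≤ p r y := by
          rcases h.step r with ⟨_, h1⟩ | ⟨e, a, b, he, hab, _, _, h0, h1, _, h3⟩
          · rw [h1] at hx; exact absurd hx hxr
          · have hadj : G.Adj a b := by
              rw [← SimpleGraph.mem_edgeSet, ← he]; exact e.2
            rw [h3] at hx
            by_cases hxa : x = a
            · subst hxa
              refine ⟨b, hadj.symm, ?_⟩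
              rw [averagingUpdate_fst] at hx
              nlinarith
            by_cases hxb : x = b
            · subst hxb
              refine ⟨a, hadj, ?_⟩
              rw [averagingUpdate_snd hab] at hx
              nlinarith
            rw [averagingUpdate_other hxa hxb] at hx
            exact absurd hx hxr
        obtain ⟨y, hyx, hy⟩ := partner
        rcases eq_or_lt_of_le hj with heq | hlt
        · exact ⟨x, hLmem (r + 1) x hx, heq.symm⟩
        · refine ih y hy j ?_
          have h1 := hconn.dist_triangle (u := u) (v := y) (w := x)
          have h2 := SimpleGraph.dist_eq_one_iff_adj.2 hyx
          omega
  intro r x hx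
  have : Nonempty V := ⟨x⟩
  choose! f hfL hfd using key r x hx
  have hle : (Finset.range (G.dist u x + 1)).card ≤ L.card := by
    refine Finset.card_le_card_of_injOn f
      (fun i hi => hfL i (Nat.lt_succ_iff.1 (Finset.mem_range.1 hi))) ?_
    intro i hi j hj hij
    rw [← hfd i (Nat.lt_succ_iff.1 (Finset.mem_range.1 hi)),
      ← hfd j (Nat.lt_succ_iff.1 (Finset.mem_range.1 hj)), hij]
  rw [Finset.card_range] at hle
  omega

/-- A nonempty finite set of vertices of an infinite connected graph has a boundary edge. -/
lemma exists_boundary_edge [Infinite V] (hconn : G.Connected) (A : Finset V) (hA : A.Nonempty) :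
    ∃ a ∈ A, ∃ b ∉ A, G.Adj a b := by
  obtain ⟨a, ha⟩ := hA
  obtain ⟨b, hb⟩ := Infinite.exists_notMem_finset A
  obtain ⟨walk⟩ := hconn.preconnected a b
  obtain ⟨d, _, h1, h2⟩ := walk.exists_boundary_dart (A : Set V) ha hb
  exact ⟨d.fst, h1, d.snd, h2, d.adj⟩

/-- If the edges near `v` receive enough weight during each of sufficiently many time windows, then
the value at `v` of a run started from a single vertex, wherever that vertex is, ends below `c`. In
a window during which the total excess does not drop, some set of high vertices stays separated,
and the weight on one of its boundary edges forces a drop after all. -/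
theorem exists_windows_decay [Infinite V] (hconn : G.Connected) {c : ℝ} (hc : 0 < c) :
    ∃ R q : ℕ, ∀ (B : Finset V) (w : ℕ → G.edgeSet → ℝ) (p : ℕ → V → ℝ) (u v : V),
      IsAveragingRun G B w p → (∀ x, x ≠ u → p 0 x = 0) → ∀ ρ : ℕ → ℕ, Monotone ρ →
      (∀ j < q, ∀ e : G.edgeSet, (∃ x ∈ (e : Sym2 V), G.dist v x ≤ R) →
        1 ≤ ∑ i ∈ Finset.Ico (ρ j) (ρ (j + 1)), w i e) →
      ∀ r, ρ q ≤ r → p r v < c := by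
  obtain ⟨K, hK⟩ := exists_nat_ge (1 / (c / 2))
  have hK' : 1 ≤ K * (c / 2) := (div_le_iff₀ (by linarith)).1 hK
  have hδ := gapWidth_pos hc K
  obtain ⟨n, hn⟩ := exists_nat_gt ((K + 1) / (gapWidth c K / 4))
  rw [div_lt_iff₀ (by linarith)] at hn
  obtain ⟨g, hg⟩ := exists_dist_high_le hconn (half_pos hc)
  refine ⟨2 * g, n, fun B w p u v h hu ρ hρ hwin r hr => ?_⟩
  by_contra! hv
  obtain ⟨j, hj, hdrop⟩ : ∃ j < n, totalExcess B c K (p (ρ j)) - gapWidth c K / 4 <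
      totalExcess B c K (p (ρ (j + 1))) := by
    by_contra! hcon
    have hind : ∀ j ≤ n, totalExcess B c K (p (ρ j)) ≤
        totalExcess B c K (p (ρ 0)) - j * (gapWidth c K / 4) := by
      intro j hj
      induction j with
      | zero => simp
      | succ j ih =>
        have h1 := ih (by omega)
        have h2 := hcon j (by omega)
        push_cast
        linarith
    have h1 := hind n le_rfl
    have h2 := totalExcess_nonneg B c K (p (ρ n))
    have h3 := h.totalExcess_le hc K (ρ 0)
    linarith
  obtain ⟨i, hi, A, hAB, hA, hAc, hsep⟩ := h.exists_separates_of_totalExcess hc hK' (ρ j)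
  have hsep' : ∀ t, ρ j ≤ t → t ≤ ρ (j + 1) →
      Separates (gapLevel c K i) (3 * gapWidth c K / 4) A (p t) := fun t h1 h2 =>
    hsep t h1 (hdrop.trans_le (h.totalExcess_anti c K h2))
  have hjj := hρ (Nat.le_succ j)
  have hne : A.Nonempty := by
    by_contra hemp
    have hlow : ∀ x, p (ρ j) x < c := by
      intro x
      by_contra! hx
      exact hemp ⟨x, IsAveragingRun.mem_of_separates hc hi (hsep' _ le_rfl hjj) hx⟩
    have := h.lt_of_forall_lt hlow ((hρ hj.le).trans hr) v
    linarith
  obtain ⟨a, ha, b, hb, hab⟩ := exists_boundary_edge hconn A hne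
  have hd1 : G.dist u a ≤ g := hg B w p u h hu _ a (hAc a ha)
  have hd2 : G.dist u v ≤ g := hg B w p u h hu r v (by linarith)
  have hd3 : G.dist v a ≤ 2 * g := by
    have h1 := hconn.dist_triangle (u := v) (v := u) (w := a)
    rw [SimpleGraph.dist_comm (u := v) (v := u)] at h1
    omega
  have hw := hwin j hj ⟨s(a, b), hab⟩ ⟨a, Sym2.mem_mk_left a b, hd3⟩
  have hsum : (∑ i ∈ Finset.Ico (ρ j) (ρ (j + 1)), w i ⟨s(a, b), hab⟩) *
      (2 * (3 * gapWidth c K / 4)) ≤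
      excess B (gapLevel c K i) (p (ρ j)) - excess B (gapLevel c K i) (p (ρ (j + 1))) := by
    have htel := Finset.sum_Ico_sub (fun t => excess B (gapLevel c K i) (p t)) hjj
    rw [Finset.sum_mul, ← neg_sub, ← htel, ← Finset.sum_neg_distrib]
    refine Finset.sum_le_sum fun t ht => ?_
    rw [Finset.mem_Ico] at ht
    rw [neg_sub]
    exact h.weight_mul_le_excess_sub (by linarith) hAB (hsep' t ht.1 ht.2.le)
      (hsep' (t + 1) (by omega) (by omega)) rfl ha hb
  have h4 := h.excess_sub_le c hi hjj
  nlinarith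

end Decay

/-! ### The averaging dynamics on a finite time grid -/

section Grid

variable {V : Type*} {G : SimpleGraph V}

open Classical in
/-- The end of `e` opposite to `x`, and `x` itself if `x` is not an end of `e`. -/
noncomputable def otherEnd (e : Sym2 V) (x : V) : V :=
  if h : x ∈ e then Sym2.Mem.other h else x

lemma otherEnd_mk_left (x y : V) : otherEnd s(x, y) x = y := by
  have h : x ∈ s(x, y) := Sym2.mem_mk_left x y
  rw [otherEnd, dif_pos h]
  exact Sym2.congr_right.1 (Sym2.other_spec h)

lemma otherEnd_mk_right (x y : V) : otherEnd s(x, y) y = x := by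
  rw [Sym2.eq_swap, otherEnd_mk_left]

lemma otherEnd_of_notMem {e : Sym2 V} {x : V} (h : x ∉ e) : otherEnd e x = x := by
  rw [otherEnd, dif_neg h]

lemma mk_otherEnd {e : Sym2 V} {x : V} (h : x ∈ e) : e = s(x, otherEnd e x) := by
  rw [otherEnd, dif_pos h]
  exact (Sym2.other_spec h).symm

lemma otherEnd_otherEnd (e : Sym2 V) (x : V) : otherEnd e (otherEnd e x) = x := by
  by_cases h : x ∈ e
  · have h1 := mk_otherEnd h
    generalize otherEnd e x = y at h1
    rw [h1, otherEnd_mk_right]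
  · rw [otherEnd_of_notMem h, otherEnd_of_notMem h]

lemma otherEnd_mem {e : Sym2 V} {x : V} (h : x ∈ e) : otherEnd e x ∈ e := by
  have h1 := Sym2.mem_mk_right x (otherEnd e x)
  rwa [← mk_otherEnd h] at h1

lemma averagingUpdate_eq_otherEnd {x y : V} (hxy : x ≠ y) (μ : ℝ) (p : V → ℝ) (z : V) :
    averagingUpdate μ x y p z = p z + μ * (p (otherEnd s(x, y) z) - p z) := by
  by_cases hx : z = x
  · subst hx; rw [averagingUpdate_fst, otherEnd_mk_left]; ring
  by_cases hy : z = y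
  · subst hy; rw [averagingUpdate_snd hxy, otherEnd_mk_right]; ring
  rw [averagingUpdate_other hx hy, otherEnd_of_notMem (by simp [hx, hy])]; ring

/-- The profile after averaging simultaneously along the edges in `F` with weights `w`. It is only
used when at most one of these weights is nonzero. -/
noncomputable def gridStep (F : Finset G.edgeSet) (w : G.edgeSet → ℝ) (p : V → ℝ) : V → ℝ :=
  fun z => p z + ∑ e ∈ F, w e * (p (otherEnd e z) - p z)

/-- The profile after `i` averaging steps with weights `w 0, …, w (i - 1)`. -/
noncomputable def gridRun (F : Finset G.edgeSet) (w : ℕ → G.edgeSet → ℝ) (p : V → ℝ) :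
    ℕ → V → ℝ
  | 0 => p
  | i + 1 => gridStep F (w i) (gridRun F w p i)

open Classical in
/-- The weight with which the edge `e` is updated in the `i`-th piece `(s i, s (i + 1)]` of the time
grid, if it has an event there; it is zero for edges outside `F`. -/
noncomputable def gridExtent (F : Finset G.edgeSet) (s : ℕ → ℝ≥0) (n : G.edgeSet → ℝ≥0 → ℕ)
    (m : G.edgeSet → ℕ → ℝ) (i : ℕ) (e : G.edgeSet) : ℝ :=
  if e ∈ F ∧ n e (s (i + 1)) ≠ n e (s i) then m e (n e (s i)) else 0

/-- The time grid resolves the events on the edges in `F`: in each of its pieces there is at most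
one event on all these edges together; moreover the extents of the updates are admissible. -/
structure GridResolves (F : Finset G.edgeSet) (s : ℕ → ℝ≥0) (n : G.edgeSet → ℝ≥0 → ℕ)
    (m : G.edgeSet → ℕ → ℝ) : Prop where
  mono : ∀ i, ∀ e ∈ F, n e (s i) ≤ n e (s (i + 1))
  unit : ∀ i, ∀ e ∈ F, n e (s (i + 1)) ≤ n e (s i) + 1
  exclusive : ∀ i, ∀ e ∈ F, ∀ f ∈ F, n e (s (i + 1)) ≠ n e (s i) →
    n f (s (i + 1)) ≠ n f (s i) → e = f
  extent : ∀ i, ∀ e ∈ F, gridExtent F s n m i e ∈ Set.Icc (0 : ℝ) (1 / 2)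

/-- The vertices whose values can influence the value at `v`, going back in time: `ch j` is the set
of edges with an event in the `j`-th piece of time counted from the end, and `influence ch v j` are
the vertices with influence from before the last `j` pieces. -/
def influence (ch : ℕ → Set G.edgeSet) (v : V) : ℕ → Set V
  | 0 => {v}
  | j + 1 => {x | x ∈ influence ch v j ∨ ∃ e ∈ ch j, otherEnd (e : Sym2 V) x ∈ influence ch v j}

lemma influence_mono (ch : ℕ → Set G.edgeSet) (v : V) : Monotone (influence ch v) :=
  monotone_nat_of_le_succ fun _ _ hx => Or.inl hx

/-- The edges of `F` with an event in the `j`-th of the `K` grid pieces, counted from the end. -/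
def eventEdges (F : Finset G.edgeSet) (s : ℕ → ℝ≥0) (K : ℕ) (n : G.edgeSet → ℝ≥0 → ℕ) (j : ℕ) :
    Set G.edgeSet :=
  {e | e ∈ F ∧ n e (s (K - 1 - j + 1)) - n e (s (K - 1 - j)) ≠ 0}

variable {F : Finset G.edgeSet} {s : ℕ → ℝ≥0} {n : G.edgeSet → ℝ≥0 → ℕ} {m : G.edgeSet → ℕ → ℝ}

lemma gridExtent_eq_zero {i : ℕ} {e : G.edgeSet} (h : n e (s (i + 1)) = n e (s i)) :
    gridExtent F s n m i e = 0 := by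
  simp [gridExtent, h]

lemma gridExtent_of_notMem {i : ℕ} {e : G.edgeSet} (h : e ∉ F) : gridExtent F s n m i e = 0 := by
  simp [gridExtent, h]

lemma gridExtent_of_ne {i : ℕ} {e : G.edgeSet} (he : e ∈ F) (h : n e (s (i + 1)) ≠ n e (s i)) :
    gridExtent F s n m i e = m e (n e (s i)) := by
  simp [gridExtent, h, he]

namespace GridResolves

lemma gridStep_of_event (h : GridResolves F s n m) {i : ℕ} {e : G.edgeSet} (he : e ∈ F)
    (hev : n e (s (i + 1)) ≠ n e (s i)) (p : V → ℝ) (z : V) :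
    gridStep F (gridExtent F s n m i) p z =
      p z + m e (n e (s i)) * (p (otherEnd e z) - p z) := by
  unfold gridStep
  rw [Finset.sum_eq_single_of_mem e he, gridExtent_of_ne he hev]
  intro f hf hfe
  have : n f (s (i + 1)) = n f (s i) := by
    by_contra hne
    exact hfe (h.exclusive i f hf e he hne hev)
  rw [gridExtent_eq_zero this, zero_mul]

/-- The grid dynamics reproduces the values of a trajectory wherever these can influence the final
value at `v`. -/
lemma gridRun_eq (h : GridResolves F s n m) {x : ℝ≥0 → V → ℝ} (hs : Monotone s)
    (hx : IsAveragingTrajectory G n m x) {v : V} {K : ℕ} {U : Set V}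
    (hU : influence (eventEdges F s K n) v K ⊆ U)
    (hF : ∀ e : G.edgeSet, ∀ z ∈ (e : Sym2 V), z ∈ U → e ∈ F) :
    ∀ i ≤ K, ∀ z ∈ influence (eventEdges F s K n) v (K - i),
      x (s i) z = gridRun F (gridExtent F s n m) (x (s 0)) i z := by
  intro i
  induction i with
  | zero => intro _ z _; rfl
  | succ i ih =>
    intro hi z hz
    obtain ⟨j, hj⟩ : ∃ j, K = i + 1 + j := ⟨K - (i + 1), by omega⟩
    have e1 : K - (i + 1) = j := by omega
    have e2 : K - i = j + 1 := by omega
    have e3 : K - 1 - j = i := by omega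
    rw [e1] at hz
    have ih := ih (by omega)
    rw [e2] at ih
    have hzU : ∀ y ∈ influence (eventEdges F s K n) v (j + 1), y ∈ U := fun y hy =>
      hU (influence_mono _ _ (by omega) hy)
    have hz' : z ∈ influence (eventEdges F s K n) v (j + 1) := influence_mono _ _ (by omega) hz
    change x (s (i + 1)) z = gridStep F (gridExtent F s n m i) _ z
    by_cases hex : ∃ e : G.edgeSet, z ∈ (e : Sym2 V) ∧ n e (s (i + 1)) ≠ n e (s i)
    · obtain ⟨e, hze, hev⟩ := hex
      have heF : e ∈ F := hF e z hze (hzU z hz')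
      have hy' : otherEnd (e : Sym2 V) z ∈ influence (eventEdges F s K n) v (j + 1) := by
        refine Or.inr ⟨e, ⟨heF, ?_⟩, ?_⟩
        · rw [e3]
          have h1 := h.mono i e heF
          omega
        · rw [otherEnd_otherEnd]; exact hz
      have hunit : n e (s (i + 1)) = n e (s i) + 1 := by
        have h1 := h.mono i e heF
        have h2 := h.unit i e heF
        omega
      have hupd := (hx.update e z (otherEnd (e : Sym2 V) z) (s i) (s (i + 1)) (mk_otherEnd hze)
        (hs (Nat.le_succ i)) hunit ?_).1
      · rw [hupd, averagingUpdate_fst, h.gridStep_of_event heF hev, ← ih z hz', ← ih _ hy']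
        ring
      · intro f hfe hf
        by_contra hne
        have hfF : f ∈ F := by
          rcases hf with hf | hf
          · exact hF f z hf (hzU z hz')
          · exact hF f _ hf (hzU _ hy')
        exact hfe (h.exclusive i f hfF e heF hne hev)
    · push Not at hex
      rw [hx.stay z (s i) (s (i + 1)) (hs (Nat.le_succ i)) hex, ih z hz', gridStep,
        Finset.sum_eq_zero, add_zero]
      intro e _
      by_cases hze : z ∈ (e : Sym2 V)
      · rw [gridExtent_eq_zero (hex e hze), zero_mul]
      · rw [otherEnd_of_notMem hze, sub_self, mul_zero]

/-- Started from a single vertex, the grid dynamics is a run of averaging steps. -/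
lemma isAveragingRun [DecidableEq V] (h : GridResolves F s n m) {B : Finset V}
    (hB : ∀ e ∈ F, ∀ z ∈ (e : Sym2 V), z ∈ B) (u : V) (hu : u ∈ B) :
    IsAveragingRun G B (gridExtent F s n m)
      (gridRun F (gridExtent F s n m) (Pi.single u 1)) where
  nonneg_zero x := by
    change 0 ≤ (Pi.single u 1 : V → ℝ) x
    rw [Pi.single_apply]; split_ifs <;> norm_num
  support_zero x hx := by
    change (Pi.single u 1 : V → ℝ) x = 0
    rw [Pi.single_apply, if_neg (ne_of_mem_of_not_mem hu hx).symm]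
  mass_zero := by
    change ∑ x ∈ B, (Pi.single u 1 : V → ℝ) x ≤ 1
    rw [Finset.sum_eq_single_of_mem u hu]
    · simp
    · intro x _ hx
      rw [Pi.single_apply, if_neg hx]
  step i := by
    by_cases hex : ∃ e ∈ F, n e (s (i + 1)) ≠ n e (s i)
    · right
      obtain ⟨e, heF, hev⟩ := hex
      obtain ⟨⟨x, y⟩, hxy⟩ := Quot.exists_rep (e : Sym2 V)
      have hxy : (e : Sym2 V) = s(x, y) := hxy.symm
      have hne : x ≠ y := by
        have : G.Adj x y := by rw [← SimpleGraph.mem_edgeSet, ← hxy]; exact e.2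
        exact this.ne
      refine ⟨e, x, y, hxy, hne, hB e heF x ?_, hB e heF y ?_, (h.extent i e heF).1,
        (h.extent i e heF).2, ?_, ?_⟩
      · rw [hxy]; exact Sym2.mem_mk_left _ _
      · rw [hxy]; exact Sym2.mem_mk_right _ _
      · intro f hfe
        by_cases hf : f ∈ F
        · apply gridExtent_eq_zero
          by_contra hne
          exact hfe (h.exclusive i f hf e heF hne hev)
        · exact gridExtent_of_notMem hf
      · funext z
        change gridStep F (gridExtent F s n m i) _ z = _
        rw [h.gridStep_of_event heF hev, gridExtent_of_ne heF hev,
          averagingUpdate_eq_otherEnd hne, hxy]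
    · left
      push Not at hex
      have h0 : ∀ e, gridExtent F s n m i e = 0 := by
        intro e
        by_cases he : e ∈ F
        · exact gridExtent_eq_zero (hex e he)
        · exact gridExtent_of_notMem he
      refine ⟨h0, ?_⟩
      funext z
      change gridStep F (gridExtent F s n m i) _ z = _
      simp [gridStep, h0]

lemma le_of_le (h : GridResolves F s n m) {e : G.edgeSet} (he : e ∈ F) {a b : ℕ} (hab : a ≤ b) :
    n e (s a) ≤ n e (s b) :=
  monotone_nat_of_le_succ (f := fun i => n e (s i)) (fun i => h.mono i e he) hab

/-- Every event on an edge in `F` is registered exactly once by the grid. -/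
lemma sum_gridExtent (h : GridResolves F s n m) {e : G.edgeSet} (he : e ∈ F) {a b : ℕ}
    (hab : a ≤ b) :
    ∑ i ∈ Finset.Ico a b, gridExtent F s n m i e =
      ∑ k ∈ Finset.Ico (n e (s a)) (n e (s b)), m e k := by
  induction b, hab using Nat.le_induction with
  | base => simp
  | succ b hab ih =>
    rw [Finset.sum_Ico_succ_top hab, ih]
    by_cases hev : n e (s (b + 1)) = n e (s b)
    · rw [gridExtent_eq_zero hev, hev, add_zero]
    · have h1 := h.mono b e he
      have h2 := h.unit b e he
      have h3 : n e (s (b + 1)) = n e (s b) + 1 := by omega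
      rw [gridExtent_of_ne he hev, h3, Finset.sum_Ico_succ_top (h.le_of_le he hab)]

end GridResolves

/-- The grid dynamics is linear in the initial profile. -/
lemma gridRun_eq_sum [DecidableEq V] {B : Finset V} (hB : ∀ e ∈ F, ∀ z ∈ (e : Sym2 V), z ∈ B)
    (w : ℕ → G.edgeSet → ℝ) (p : V → ℝ) (i : ℕ) {z : V} (hz : z ∈ B) :
    gridRun F w p i z = ∑ u ∈ B, gridRun F w (Pi.single u 1) i z * p u := by
  induction i generalizing z with
  | zero =>
    change p z = ∑ u ∈ B, (Pi.single u 1 : V → ℝ) z * p u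
    rw [Finset.sum_eq_single_of_mem z hz]
    · simp
    · intro u _ hu
      rw [Pi.single_apply, if_neg hu.symm, zero_mul]
  | succ i ih =>
    have hcl : ∀ e ∈ F, otherEnd (e : Sym2 V) z ∈ B := by
      intro e he
      by_cases hze : z ∈ (e : Sym2 V)
      · exact hB e he _ (otherEnd_mem hze)
      · rw [otherEnd_of_notMem hze]; exact hz
    change gridStep F (w i) (gridRun F w p i) z =
      ∑ u ∈ B, gridStep F (w i) (gridRun F w (Pi.single u 1) i) z * p u
    simp only [gridStep, add_mul, Finset.sum_add_distrib, Finset.sum_mul]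
    rw [ih hz, Finset.sum_comm]
    congr 1
    refine Finset.sum_congr rfl fun e he => ?_
    rw [ih (hcl e he), ← Finset.sum_sub_distrib, Finset.mul_sum]
    exact Finset.sum_congr rfl fun u _ => by ring

lemma gridRun_one (w : ℕ → G.edgeSet → ℝ) (i : ℕ) : gridRun F w (fun _ => 1) i = fun _ => 1 := by
  induction i with
  | zero => rfl
  | succ i ih =>
    change gridStep F (w i) (gridRun F w _ i) = _
    rw [ih]
    funext z
    simp [gridStep]

lemma sum_gridRun_single [DecidableEq V] {B : Finset V}
    (hB : ∀ e ∈ F, ∀ z ∈ (e : Sym2 V), z ∈ B) (w : ℕ → G.edgeSet → ℝ) (i : ℕ) {z : V}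
    (hz : z ∈ B) : ∑ u ∈ B, gridRun F w (Pi.single u 1) i z = 1 := by
  have h := gridRun_eq_sum hB w (fun _ => 1) i hz
  rw [gridRun_one] at h
  simpa using h.symm

end Grid

/-! ### Poisson clocks -/

section Poisson

lemma poissonMeasure_real_ne_zero_le (a : ℝ≥0) : (poissonMeasure a).real {k | k ≠ 0} ≤ a := by
  have h1 : {k : ℕ | k ≠ 0} = {0}ᶜ := by ext; simp
  rw [h1, probReal_compl_eq_one_sub (MeasurableSet.singleton 0), poissonMeasure_real_singleton]
  have := Real.add_one_le_exp (-(a : ℝ))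
  simp
  linarith

lemma poissonMeasure_real_two_le_le (a : ℝ≥0) : (poissonMeasure a).real {k | 2 ≤ k} ≤ a ^ 2 := by
  have h1 : {k : ℕ | 2 ≤ k} = (({0, 1} : Finset ℕ) : Set ℕ)ᶜ := by
    ext k; simp; omega
  rw [h1, probReal_compl_eq_one_sub (Finset.measurableSet _), ← sum_measureReal_singleton]
  simp only [poissonMeasure_real_singleton]
  rw [Finset.sum_pair (by norm_num)]
  have h2 := Real.add_one_le_exp (-(a : ℝ))
  have h3 : (0 : ℝ) ≤ a := a.2
  simp
  nlinarith

lemma tendsto_poissonMeasure_real_lt (k : ℕ) :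
    Tendsto (fun a : ℝ≥0 => (poissonMeasure a).real {j | j < k}) atTop (𝓝 0) := by
  have h1 : {j : ℕ | j < k} = ((Finset.range k : Finset ℕ) : Set ℕ) := by ext; simp
  rw [h1]
  simp only [← sum_measureReal_singleton, poissonMeasure_real_singleton]
  rw [← Finset.sum_const_zero (s := Finset.range k)]
  refine tendsto_finsetSum _ fun j _ => ?_
  have h2 := (Real.tendsto_pow_mul_exp_neg_atTop_nhds_zero j).div_const (j.factorial : ℝ)
  rw [zero_div] at h2
  refine (h2.comp (NNReal.tendsto_coe_atTop.2 tendsto_id)).congr fun a => ?_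
  simp only [Function.comp, id]
  ring

end Poisson

section Clocks

variable {Ω : Type*} [MeasurableSpace Ω] {P : Measure Ω} {lam : ℝ≥0}

namespace IsPoissonProcess

variable {N : ℝ≥0 → Ω → ℕ}

lemma real_increment_ne_zero_le (h : IsPoissonProcess lam N P) {s t : ℝ≥0} (hst : s ≤ t) :
    P.real {ω | N t ω - N s ω ≠ 0} ≤ lam * (t - s : ℝ≥0) := by
  rw [(h.law_increment s t hst).measureReal_eq (p := fun k => k ≠ 0) (by measurability)]
  exact_mod_cast poissonMeasure_real_ne_zero_le (lam * (t - s))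

lemma real_two_le_increment_le (h : IsPoissonProcess lam N P) {s t : ℝ≥0} (hst : s ≤ t) :
    P.real {ω | 2 ≤ N t ω - N s ω} ≤ (lam * (t - s : ℝ≥0)) ^ 2 := by
  rw [(h.law_increment s t hst).measureReal_eq (p := fun k => 2 ≤ k) (by measurability)]
  exact_mod_cast poissonMeasure_real_two_le_le (lam * (t - s))

/-- Almost surely there are infinitely many events. -/
lemma ae_tendsto_atTop [IsProbabilityMeasure P] (h : IsPoissonProcess lam N P) (hlam : 0 < lam) :
    ∀ᵐ ω ∂P, Tendsto (fun b : ℕ => N b ω) atTop atTop := by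
  have key : ∀ k : ℕ, ∀ᵐ ω ∂P, ∃ b : ℕ, k ≤ N b ω := by
    intro k
    have h0 : P.real {ω | ¬ ∃ b : ℕ, k ≤ N b ω} ≤ 0 := by
      have hlim : Tendsto (fun b : ℕ => (poissonMeasure (lam * ((b : ℝ≥0) - 0))).real {j | j < k})
          atTop (𝓝 0) := by
        refine (tendsto_poissonMeasure_real_lt k).comp ?_
        simp only [tsub_zero]
        exact tendsto_natCast_atTop_atTop.const_mul_atTop hlam
      refine ge_of_tendsto' hlim fun b => ?_
      rw [← (h.law_increment 0 b zero_le).measureReal_eq (p := fun j => j < k)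
        (by measurability)]
      refine measureReal_mono fun ω hω => ?_
      simp only [Set.mem_ofPred_eq, not_exists, not_le] at hω ⊢
      exact (Nat.sub_le _ _).trans_lt (hω b)
    have h1 := le_antisymm h0 measureReal_nonneg
    rw [measureReal_eq_zero_iff] at h1
    exact h1
  filter_upwards [ae_all_iff.2 key, h.mono] with ω h1 h2
  refine tendsto_atTop_atTop_of_monotone (fun a b hab => h2 (by exact_mod_cast hab)) h1

end IsPoissonProcess

end Clocks

section Increments

/-- Whether a vertex belongs to the influence set is decided by the events in the pieces already
passed. -/
lemma measurableSet_mem_influence {V Ω : Type*} {G : SimpleGraph V} {F : Finset G.edgeSet}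
    {m : MeasurableSpace Ω} {ch : Ω → ℕ → Set G.edgeSet} {v : V}
    {j : ℕ} (hF : ∀ ω i, ch ω i ⊆ F)
    (hch : ∀ i < j, ∀ e ∈ F, MeasurableSet[m] {ω | e ∈ ch ω i}) (x : V) :
    MeasurableSet[m] {ω | x ∈ influence (ch ω) v j} := by
  induction j generalizing x with
  | zero =>
    change MeasurableSet[m] {_ω | x ∈ ({v} : Set V)}
    exact MeasurableSet.const _
  | succ j ih =>
    have ih := ih fun i hi => hch i (by omega)
    have heq : {ω | x ∈ influence (ch ω) v (j + 1)} = {ω | x ∈ influence (ch ω) v j} ∪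
        ⋃ e ∈ F, {ω | e ∈ ch ω j} ∩ {ω | otherEnd (e : Sym2 V) x ∈ influence (ch ω) v j} := by
      ext ω
      simp only [influence, Set.mem_ofPred_eq, Set.mem_union, Set.mem_iUnion, Set.mem_inter_iff]
      refine or_congr Iff.rfl ⟨?_, ?_⟩
      · rintro ⟨e, he, hx⟩
        exact ⟨e, hF ω j he, he, hx⟩
      · rintro ⟨e, _, he, hx⟩
        exact ⟨e, he, hx⟩
    rw [heq]
    exact (ih x).union (F.measurableSet_biUnion fun e he => (hch j (by omega) e he).inter (ih _))

variable {V Ω : Type*} [MeasurableSpace Ω] {P : Measure Ω}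
  {G : SimpleGraph V} {lam : ℝ≥0} {N : G.edgeSet → ℝ≥0 → Ω → ℕ} {M : G.edgeSet → ℕ → Ω → ℝ}
  {η : ℝ≥0 → V → Ω → ℝ}

/-- The increments of all the clocks over all the pieces of a time grid are jointly independent. -/
lemma IsAveragingProcess.iIndepFun_increments (h : IsAveragingProcess G lam N M η P)
    {s : ℕ → ℝ≥0} (hs : Monotone s) :
    iIndepFun (fun (p : G.edgeSet × ℕ) ω => N p.1 (s (p.2 + 1)) ω - N p.1 (s p.2) ω) P := by
  refine iIndepFun_uncurry' (X := fun (e : G.edgeSet) (i : ℕ) ω => N e (s (i + 1)) ω - N e (s i) ω)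
    (fun e i => ((h.poisson e).measurable _).sub ((h.poisson e).measurable _)) ?_ ?_
  · exact h.indep_clocks.comp (fun _ (path : ℝ≥0 → ℕ) (i : ℕ) => path (s (i + 1)) - path (s i))
      (fun _ => measurable_pi_lambda _ fun i =>
        (measurable_pi_apply _).sub (measurable_pi_apply _))
  · exact fun e => (h.poisson e).indepIncrements.nat hs

variable {F : Finset G.edgeSet} {s : ℕ → ℝ≥0}

/-- Events in a piece of time are independent of the influence set from after that piece. -/
lemma IsAveragingProcess.real_event_inter_influence (h : IsAveragingProcess G lam N M η P)
    (hs : Monotone s) {K j : ℕ} (hj : j < K) {e : G.edgeSet} (v y : V) :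
    P.real ({ω | N e (s (K - 1 - j + 1)) ω - N e (s (K - 1 - j)) ω ≠ 0} ∩
        {ω | y ∈ influence (eventEdges F s K fun e t => N e t ω) v j}) =
      P.real {ω | N e (s (K - 1 - j + 1)) ω - N e (s (K - 1 - j)) ω ≠ 0} *
        P.real {ω | y ∈ influence (eventEdges F s K fun e t => N e t ω) v j} := by
  classical
  have hmeas : ∀ p : G.edgeSet × ℕ,
      Measurable fun ω => N p.1 (s (p.2 + 1)) ω - N p.1 (s p.2) ω :=
    fun p => ((h.poisson p.1).measurable _).sub ((h.poisson p.1).measurable _)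
  set S : Finset (G.edgeSet × ℕ) := {(e, K - 1 - j)} with hS
  set T : Finset (G.edgeSet × ℕ) := F ×ˢ (Finset.range j).image (fun i => K - 1 - i) with hT
  have hdisj : Disjoint S T := by
    rw [Finset.disjoint_singleton_left, hT, Finset.mem_product, not_and]
    intro _ hmem
    obtain ⟨i, hi, hij⟩ := Finset.mem_image.1 hmem
    have := Finset.mem_range.1 hi
    simp only at hij
    omega
  have hind := (h.iIndepFun_increments hs).indepFun_finset S T hdisj hmeas
  have hind := IndepFun_iff _ _ _ |>.1 hind
  simp only [measureReal_def, ← ENNReal.toReal_mul]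
  congr 1
  apply hind
  · refine ⟨{g | g ⟨(e, K - 1 - j), Finset.mem_singleton_self _⟩ ≠ 0}, ?_, rfl⟩
    have hm : Measurable fun g : S → ℕ => g ⟨(e, K - 1 - j), Finset.mem_singleton_self _⟩ :=
      measurable_pi_apply _
    exact hm (MeasurableSet.of_discrete (s := {k : ℕ | k ≠ 0}))
  · refine measurableSet_mem_influence (F := F) (fun ω i e he => he.1) (fun i hi f hf => ?_) y
    have hmem : (f, K - 1 - i) ∈ T :=
      Finset.mem_product.2 ⟨hf, Finset.mem_image_of_mem _ (Finset.mem_range.2 hi)⟩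
    have hm : Measurable fun g : T → ℕ => g ⟨(f, K - 1 - i), hmem⟩ := measurable_pi_apply _
    refine ⟨{g | g ⟨(f, K - 1 - i), hmem⟩ ≠ 0},
      hm (MeasurableSet.of_discrete (s := {k : ℕ | k ≠ 0})), ?_⟩
    ext ω
    simp [eventEdges, hf]

end Increments

/-! ### Finite neighbourhoods -/

section Balls

variable {V : Type*} {G : SimpleGraph V} [G.LocallyFinite]

lemma exists_finset_ball (hconn : G.Connected) (v : V) (m : ℕ) :
    ∃ B : Finset V, ∀ x, x ∈ B ↔ G.dist v x ≤ m := by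
  classical
  induction m with
  | zero => exact ⟨{v}, fun x => by simp [hconn.dist_eq_zero_iff, eq_comm]⟩
  | succ m ih =>
    obtain ⟨B, hB⟩ := ih
    refine ⟨B ∪ B.biUnion fun y => G.neighborFinset y, fun x => ?_⟩
    simp only [Finset.mem_union, Finset.mem_biUnion, hB, SimpleGraph.mem_neighborFinset]
    constructor
    · rintro (h | ⟨y, hy, hyx⟩)
      · omega
      · have h1 := hconn.dist_triangle (u := v) (v := y) (w := x)
        have h2 := SimpleGraph.dist_eq_one_iff_adj.2 hyx
        omega
    · intro h
      obtain ⟨walk, hw⟩ := hconn.exists_walk_length_eq_dist x v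
      cases walk with
      | nil => left; simp
      | @cons _ y _ hxy q =>
        right
        refine ⟨y, ?_, hxy.symm⟩
        have h1 := SimpleGraph.dist_le q
        rw [SimpleGraph.Walk.length_cons, SimpleGraph.dist_comm] at hw
        rw [SimpleGraph.dist_comm]
        omega

omit [G.LocallyFinite] in
lemma exists_finset_edges (B : Finset V) :
    ∃ F : Finset G.edgeSet, ∀ e, e ∈ F ↔ ∀ z ∈ (e : Sym2 V), z ∈ B := by
  have hfin : {e : G.edgeSet | ∀ z ∈ (e : Sym2 V), z ∈ B}.Finite := by
    refine Set.Finite.of_finite_image (f := Subtype.val) ?_ Subtype.val_injective.injOn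
    refine B.sym2.finite_toSet.subset ?_
    rintro _ ⟨e, he, rfl⟩
    exact Finset.mem_coe.2 (Finset.mem_sym2_iff.2 he)
  exact ⟨hfin.toFinset, fun e => hfin.mem_toFinset⟩

lemma card_filter_mem_le {D : ℕ} (hdeg : ∀ v, G.degree v ≤ D) (F : Finset G.edgeSet) (y : V)
    [DecidablePred fun e : G.edgeSet => y ∈ (e : Sym2 V)] :
    (F.filter fun e : G.edgeSet => y ∈ (e : Sym2 V)).card ≤ D := by
  refine le_trans ?_ (hdeg y)
  refine Finset.card_le_card_of_injOn (fun e => otherEnd (e : Sym2 V) y) ?_ ?_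
  · intro e he
    have he' := (Finset.mem_filter.1 he).2
    have h1 := e.2
    rw [mk_otherEnd he', SimpleGraph.mem_edgeSet] at h1
    exact Finset.mem_coe.2 ((G.mem_neighborFinset _ _).2 h1)
  · intro e he f hf hef
    have he' := mk_otherEnd (Finset.mem_filter.1 he).2
    have hf' := mk_otherEnd (Finset.mem_filter.1 hf).2
    simp only at hef
    apply Subtype.ext
    rw [he', hf', hef]

end Balls

/-! ### Influence does not spread far -/

section Spread

variable {V Ω : Type*} [MeasurableSpace Ω] {P : Measure Ω} [IsProbabilityMeasure P]
  {G : SimpleGraph V} [G.LocallyFinite] {lam : ℝ≥0} {N : G.edgeSet → ℝ≥0 → Ω → ℕ}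
  {M : G.edgeSet → ℕ → Ω → ℝ} {η : ℝ≥0 → V → Ω → ℝ} {F : Finset G.edgeSet} {s : ℕ → ℝ≥0}

/-- Going back by one piece of time multiplies the expected exponentially weighted size of the
influence set by a factor close to one. -/
lemma IsAveragingProcess.sum_influence_succ_le (h : IsAveragingProcess G lam N M η P)
    (hconn : G.Connected) {D : ℕ} (hdeg : ∀ v, G.degree v ≤ D) (hs : Monotone s) {q : ℝ}
    (q0 : 0 ≤ q)
    (hq : ∀ (e : G.edgeSet) i, P.real {ω | N e (s (i + 1)) ω - N e (s i) ω ≠ 0} ≤ q)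
    {B : Finset V} (hB : ∀ e ∈ F, ∀ z ∈ (e : Sym2 V), z ∈ B) (v : V) {K j : ℕ} (hj : j < K) :
    ∑ x ∈ B, 2 ^ G.dist v x *
        P.real {ω | x ∈ influence (eventEdges F s K fun e t => N e t ω) v (j + 1)} ≤
      (1 + 2 * D * q) * ∑ x ∈ B, 2 ^ G.dist v x *
        P.real {ω | x ∈ influence (eventEdges F s K fun e t => N e t ω) v j} := by
  classical
  set g : V → ℝ := fun x =>
    P.real {ω | x ∈ influence (eventEdges F s K fun e t => N e t ω) v j} with hg
  have hg0 : ∀ x, 0 ≤ g x := fun x => measureReal_nonneg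
  have step : ∀ x, P.real {ω | x ∈ influence (eventEdges F s K fun e t => N e t ω) v (j + 1)} ≤
      g x + ∑ e ∈ F.filter (fun e : G.edgeSet => x ∈ (e : Sym2 V)), q * g (otherEnd (e : Sym2 V) x) := by
    intro x
    have hsub : {ω | x ∈ influence (eventEdges F s K fun e t => N e t ω) v (j + 1)} ⊆
        {ω | x ∈ influence (eventEdges F s K fun e t => N e t ω) v j} ∪
        ⋃ e ∈ F.filter (fun e : G.edgeSet => x ∈ (e : Sym2 V)),
          ({ω | N e (s (K - 1 - j + 1)) ω - N e (s (K - 1 - j)) ω ≠ 0} ∩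
          {ω | otherEnd (e : Sym2 V) x ∈
            influence (eventEdges F s K fun e t => N e t ω) v j}) := by
      rintro ω (hω | ⟨e, ⟨heF, he⟩, hx⟩)
      · exact Or.inl hω
      · by_cases hxe : x ∈ (e : Sym2 V)
        · right
          simp only [Set.mem_iUnion]
          exact ⟨e, Finset.mem_filter.2 ⟨heF, hxe⟩, he, hx⟩
        · rw [otherEnd_of_notMem hxe] at hx
          exact Or.inl hx
    refine (measureReal_mono hsub).trans ((measureReal_union_le _ _).trans ?_)
    gcongr
    refine (measureReal_biUnion_finset_le _ _).trans (Finset.sum_le_sum fun e _ => ?_)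
    rw [h.real_event_inter_influence hs hj]
    exact mul_le_mul_of_nonneg_right (hq e _) (hg0 _)
  have hswap : ∑ x ∈ B, 2 ^ G.dist v x *
      ∑ e ∈ F.filter (fun e : G.edgeSet => x ∈ (e : Sym2 V)), q * g (otherEnd (e : Sym2 V) x) ≤
      2 * D * q * ∑ x ∈ B, 2 ^ G.dist v x * g x := by
    calc ∑ x ∈ B, 2 ^ G.dist v x *
          ∑ e ∈ F.filter (fun e : G.edgeSet => x ∈ (e : Sym2 V)), q * g (otherEnd (e : Sym2 V) x)
        = ∑ e ∈ F, ∑ x ∈ B.filter (fun x => x ∈ (e : Sym2 V)),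
            2 ^ G.dist v x * (q * g (otherEnd (e : Sym2 V) x)) := by
          simp only [Finset.mul_sum]
          refine Finset.sum_comm' fun x e => ?_
          simp only [Finset.mem_filter]
          tauto
      _ ≤ ∑ e ∈ F, ∑ x ∈ B.filter (fun x => x ∈ (e : Sym2 V)),
            (2 * q) * (2 ^ G.dist v (otherEnd (e : Sym2 V) x) *
              g (otherEnd (e : Sym2 V) x)) := by
          refine Finset.sum_le_sum fun e _ => Finset.sum_le_sum fun x hx => ?_
          have hxe := (Finset.mem_filter.1 hx).2
          have hadj : G.Adj (otherEnd (e : Sym2 V) x) x := by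
            have h1 := e.2
            rw [mk_otherEnd hxe, SimpleGraph.mem_edgeSet] at h1
            exact h1.symm
          have hd : G.dist v x ≤ G.dist v (otherEnd (e : Sym2 V) x) + 1 := by
            have h1 := hconn.dist_triangle (u := v) (v := otherEnd (e : Sym2 V) x) (w := x)
            rw [SimpleGraph.dist_eq_one_iff_adj.2 hadj] at h1
            exact h1
          have hp : (2 : ℝ) ^ G.dist v x ≤ 2 ^ (G.dist v (otherEnd (e : Sym2 V) x) + 1) :=
            pow_le_pow_right₀ (by norm_num) hd
          rw [pow_succ] at hp
          nlinarith [mul_nonneg q0 (hg0 (otherEnd (e : Sym2 V) x))]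
      _ = ∑ e ∈ F, ∑ y ∈ B.filter (fun y => y ∈ (e : Sym2 V)),
            (2 * q) * (2 ^ G.dist v y * g y) := by
          refine Finset.sum_congr rfl fun e he => ?_
          have hmaps : ∀ x ∈ B.filter (fun x => x ∈ (e : Sym2 V)),
              otherEnd (e : Sym2 V) x ∈ B.filter (fun x => x ∈ (e : Sym2 V)) := by
            intro x hx
            have h1 := otherEnd_mem (Finset.mem_filter.1 hx).2
            exact Finset.mem_filter.2 ⟨hB e he _ h1, h1⟩
          exact Finset.sum_nbij' (otherEnd (e : Sym2 V)) (otherEnd (e : Sym2 V)) hmaps hmaps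
            (fun x _ => otherEnd_otherEnd _ x) (fun x _ => otherEnd_otherEnd _ x)
            (fun x _ => rfl)
      _ = ∑ y ∈ B, (F.filter (fun e : G.edgeSet => y ∈ (e : Sym2 V))).card *
            ((2 * q) * (2 ^ G.dist v y * g y)) := by
          rw [Finset.sum_comm' (t' := B) (s' := fun y => F.filter (fun e : G.edgeSet => y ∈ (e : Sym2 V)))]
          · simp only [Finset.sum_const, nsmul_eq_mul]
          · intro e y
            simp only [Finset.mem_filter]
            tauto
      _ ≤ ∑ y ∈ B, D * ((2 * q) * (2 ^ G.dist v y * g y)) := by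
          refine Finset.sum_le_sum fun y _ => ?_
          have h1 : ((F.filter (fun e : G.edgeSet => y ∈ (e : Sym2 V))).card : ℝ) ≤ D := by
            exact_mod_cast card_filter_mem_le hdeg F y
          have h2 := hg0 y
          gcongr
      _ = 2 * D * q * ∑ x ∈ B, 2 ^ G.dist v x * g x := by
          rw [Finset.mul_sum]
          exact Finset.sum_congr rfl fun y _ => by ring
  calc ∑ x ∈ B, 2 ^ G.dist v x *
        P.real {ω | x ∈ influence (eventEdges F s K fun e t => N e t ω) v (j + 1)}
      ≤ ∑ x ∈ B, 2 ^ G.dist v x * (g x +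
          ∑ e ∈ F.filter (fun e : G.edgeSet => x ∈ (e : Sym2 V)), q * g (otherEnd (e : Sym2 V) x)) :=
        Finset.sum_le_sum fun x _ => mul_le_mul_of_nonneg_left (step x) (by positivity)
    _ = ∑ x ∈ B, 2 ^ G.dist v x * g x + ∑ x ∈ B, 2 ^ G.dist v x *
          ∑ e ∈ F.filter (fun e : G.edgeSet => x ∈ (e : Sym2 V)), q * g (otherEnd (e : Sym2 V) x) := by
        simp only [mul_add, Finset.sum_add_distrib]
    _ ≤ _ := by rw [add_mul, one_mul]; gcongr

end Spread

/-! ### A fine time grid resolves the dynamics with high probability -/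

section FineGrid

variable {V Ω : Type*} [MeasurableSpace Ω] {P : Measure Ω} [IsProbabilityMeasure P]
  {G : SimpleGraph V} {lam : ℝ≥0} {N : G.edgeSet → ℝ≥0 → Ω → ℕ}
  {M : G.edgeSet → ℕ → Ω → ℝ} {η : ℝ≥0 → V → Ω → ℝ} {F : Finset G.edgeSet} {s : ℕ → ℝ≥0}

/-- Markov's inequality for the exponentially weighted size of the influence set. -/
lemma IsAveragingProcess.real_exists_far_influence_le [G.LocallyFinite]
    (h : IsAveragingProcess G lam N M η P)
    (hconn : G.Connected) {D : ℕ} (hdeg : ∀ v, G.degree v ≤ D) (hs : Monotone s) {q : ℝ}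
    (q0 : 0 ≤ q)
    (hq : ∀ (e : G.edgeSet) i, P.real {ω | N e (s (i + 1)) ω - N e (s i) ω ≠ 0} ≤ q)
    {B : Finset V} (hB : ∀ e ∈ F, ∀ z ∈ (e : Sym2 V), z ∈ B) {v : V} (hv : v ∈ B) (K m : ℕ) :
    P.real {ω | ∃ x ∈ B, m ≤ G.dist v x ∧
      x ∈ influence (eventEdges F s K fun e t => N e t ω) v K} ≤ (1 + 2 * D * q) ^ K / 2 ^ m := by
  have hind : ∀ j ≤ K, ∑ x ∈ B, 2 ^ G.dist v x *
      P.real {ω | x ∈ influence (eventEdges F s K fun e t => N e t ω) v j} ≤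
      (1 + 2 * D * q) ^ j := by
    intro j hj
    induction j with
    | zero =>
      rw [Finset.sum_eq_single_of_mem v hv]
      · simp [influence]
      · intro x _ hx
        simp [influence, hx]
    | succ j ih =>
      refine (h.sum_influence_succ_le hconn hdeg hs q0 hq hB v (by omega)).trans ?_
      rw [pow_succ, mul_comm]
      exact mul_le_mul_of_nonneg_right (ih (by omega)) (by positivity)
  rw [le_div_iff₀ (by positivity)]
  refine le_trans ?_ (hind K le_rfl)
  classical
  have hsub : {ω | ∃ x ∈ B, m ≤ G.dist v x ∧
      x ∈ influence (eventEdges F s K fun e t => N e t ω) v K} ⊆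
      ⋃ x ∈ B.filter (fun x => m ≤ G.dist v x),
        {ω | x ∈ influence (eventEdges F s K fun e t => N e t ω) v K} := by
    rintro ω ⟨x, hx, hm, hxi⟩
    simp only [Set.mem_iUnion]
    exact ⟨x, Finset.mem_filter.2 ⟨hx, hm⟩, hxi⟩
  calc _ ≤ (∑ x ∈ B.filter (fun x => m ≤ G.dist v x),
        P.real {ω | x ∈ influence (eventEdges F s K fun e t => N e t ω) v K}) * 2 ^ m := by
        gcongr
        exact (measureReal_mono hsub (measure_ne_top _ _)).trans
          (measureReal_biUnion_finset_le _ _)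
    _ ≤ ∑ x ∈ B.filter (fun x => m ≤ G.dist v x), 2 ^ G.dist v x *
        P.real {ω | x ∈ influence (eventEdges F s K fun e t => N e t ω) v K} := by
        rw [Finset.sum_mul]
        refine Finset.sum_le_sum fun x hx => ?_
        rw [mul_comm]
        gcongr
        · norm_num
        · exact (Finset.mem_filter.1 hx).2
    _ ≤ _ := Finset.sum_le_sum_of_subset_of_nonneg (Finset.filter_subset _ _)
        fun x _ _ => by positivity

/-- The points `i / 2 ^ n`, stopped at time `t`. -/
noncomputable def timeGrid (t : ℝ≥0) (n i : ℕ) : ℝ≥0 := min (i / 2 ^ n) t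

lemma timeGrid_mono (t : ℝ≥0) (n : ℕ) : Monotone (timeGrid t n) := by
  intro a b hab
  unfold timeGrid
  gcongr

lemma timeGrid_zero (t : ℝ≥0) (n : ℕ) : timeGrid t n 0 = 0 := by simp [timeGrid]

lemma timeGrid_mul (t : ℝ≥0) (n T : ℕ) : timeGrid t n (T * 2 ^ n) = min (T : ℝ≥0) t := by
  unfold timeGrid
  congr 1
  push_cast
  field_simp

lemma timeGrid_of_le {t : ℝ≥0} {n T i : ℕ} (hT : t ≤ T) (hi : T * 2 ^ n ≤ i) :
    timeGrid t n i = t := by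
  refine le_antisymm (min_le_right _ _) ?_
  calc t = timeGrid t n (T * 2 ^ n) := by rw [timeGrid_mul, min_eq_right hT]
    _ ≤ _ := timeGrid_mono t n hi

lemma timeGrid_succ_sub_le (t : ℝ≥0) (n i : ℕ) :
    timeGrid t n (i + 1) - timeGrid t n i ≤ 1 / 2 ^ n := by
  rw [tsub_le_iff_left]
  unfold timeGrid
  rcases le_total ((i : ℝ≥0) / 2 ^ n) t with h | h
  · rw [min_eq_left h]
    refine (min_le_left _ _).trans ?_
    push_cast
    rw [add_div]
  · rw [min_eq_right h]
    exact (min_le_right _ _).trans (le_add_of_nonneg_right zero_le)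

omit [IsProbabilityMeasure P] in
lemma IsAveragingProcess.real_event_timeGrid_le (h : IsAveragingProcess G lam N M η P) (t : ℝ≥0)
    (n : ℕ) (e : G.edgeSet) (i : ℕ) :
    P.real {ω | N e (timeGrid t n (i + 1)) ω - N e (timeGrid t n i) ω ≠ 0} ≤ lam / 2 ^ n := by
  refine ((h.poisson e).real_increment_ne_zero_le (timeGrid_mono t n (Nat.le_succ i))).trans ?_
  have h1 : ((timeGrid t n (i + 1) - timeGrid t n i : ℝ≥0) : ℝ) ≤ 1 / 2 ^ n := by
    exact_mod_cast timeGrid_succ_sub_le t n i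
  rw [div_eq_mul_one_div]
  exact mul_le_mul_of_nonneg_left h1 lam.2

omit [IsProbabilityMeasure P] in
lemma IsAveragingProcess.real_two_le_timeGrid_le (h : IsAveragingProcess G lam N M η P) (t : ℝ≥0)
    (n : ℕ) (e : G.edgeSet) (i : ℕ) :
    P.real {ω | 2 ≤ N e (timeGrid t n (i + 1)) ω - N e (timeGrid t n i) ω} ≤
      (lam / 2 ^ n) ^ 2 := by
  refine ((h.poisson e).real_two_le_increment_le (timeGrid_mono t n (Nat.le_succ i))).trans ?_
  have h1 : ((timeGrid t n (i + 1) - timeGrid t n i : ℝ≥0) : ℝ) ≤ 1 / 2 ^ n := by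
    exact_mod_cast timeGrid_succ_sub_le t n i
  rw [div_eq_mul_one_div (lam : ℝ)]
  gcongr

omit [IsProbabilityMeasure P] in
lemma IsAveragingProcess.real_two_events_timeGrid_le (h : IsAveragingProcess G lam N M η P)
    (t : ℝ≥0) (n : ℕ) {e f : G.edgeSet} (hef : e ≠ f) (i : ℕ) :
    P.real ({ω | N e (timeGrid t n (i + 1)) ω - N e (timeGrid t n i) ω ≠ 0} ∩
      {ω | N f (timeGrid t n (i + 1)) ω - N f (timeGrid t n i) ω ≠ 0}) ≤ (lam / 2 ^ n) ^ 2 := by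
  have hg : Measurable fun path : ℝ≥0 → ℕ =>
      path (timeGrid t n (i + 1)) - path (timeGrid t n i) :=
    (measurable_pi_apply _).sub (measurable_pi_apply _)
  have hind := (h.indep_clocks.indepFun hef).comp hg hg
  have hS : MeasurableSet {k : ℕ | k ≠ 0} := MeasurableSet.of_discrete
  have heq := hind.measure_inter_preimage_eq_mul _ _ hS hS
  have heq' : P.real ({ω | N e (timeGrid t n (i + 1)) ω - N e (timeGrid t n i) ω ≠ 0} ∩
      {ω | N f (timeGrid t n (i + 1)) ω - N f (timeGrid t n i) ω ≠ 0}) =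
      P.real {ω | N e (timeGrid t n (i + 1)) ω - N e (timeGrid t n i) ω ≠ 0} *
      P.real {ω | N f (timeGrid t n (i + 1)) ω - N f (timeGrid t n i) ω ≠ 0} := by
    simp only [measureReal_def, ← ENNReal.toReal_mul]
    exact congrArg ENNReal.toReal heq
  rw [heq', sq]
  exact mul_le_mul (h.real_event_timeGrid_le t n e i) (h.real_event_timeGrid_le t n f i)
    measureReal_nonneg (by positivity)

/-- The probability that two events fall in the same piece of the grid is of the order of the mesh
of the grid. -/
lemma IsAveragingProcess.real_not_gridResolves_le (h : IsAveragingProcess G lam N M η P)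
    (F : Finset G.edgeSet) {t : ℝ≥0} {T : ℕ} (hT : t ≤ T) (n : ℕ) :
    P.real {ω | ¬ GridResolves F (timeGrid t n) (fun e t => N e t ω) (fun e k => M e k ω)} ≤
      T * 2 ^ n * ((F.card + F.card ^ 2) * (lam / 2 ^ n) ^ 2) := by
  classical
  set A : ℕ → G.edgeSet → Set Ω := fun i e =>
    {ω | N e (timeGrid t n (i + 1)) ω - N e (timeGrid t n i) ω ≠ 0} with hA
  set A2 : ℕ → G.edgeSet → Set Ω := fun i e =>
    {ω | 2 ≤ N e (timeGrid t n (i + 1)) ω - N e (timeGrid t n i) ω} with hA2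
  set bad : Set Ω := ⋃ i ∈ Finset.range (T * 2 ^ n), ((⋃ e ∈ F, A2 i e) ∪
    ⋃ p ∈ F.offDiag, (A i p.1 ∩ A i p.2)) with hbad
  have hsub : {ω | ¬ GridResolves F (timeGrid t n) (fun e t => N e t ω) (fun e k => M e k ω)}
      ≤ᵐ[P] bad := by
    have h1 : ∀ᵐ ω ∂P, ∀ e ∈ F, Monotone fun t => N e t ω :=
      (Finset.eventually_all F).2 fun e _ => (h.poisson e).mono
    have h2 : ∀ᵐ ω ∂P, ∀ e ∈ F, ∀ k, M e k ω ∈ Set.Ioc (0 : ℝ) (1 / 2) :=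
      (Finset.eventually_all F).2 fun e _ => ae_all_iff.2 fun k => h.extent_mem e k
    filter_upwards [h1, h2] with ω h1 h2 hω
    by_contra hgood
    apply hω
    have hgood' : ∀ i < T * 2 ^ n, (∀ e ∈ F, ω ∉ A2 i e) ∧
        ∀ e ∈ F, ∀ f ∈ F, e ≠ f → ω ∈ A i e → ω ∉ A i f := by
      intro i hi
      constructor
      · intro e he hω
        apply hgood
        change ω ∈ bad
        simp only [hbad, Set.mem_iUnion]
        exact ⟨i, Finset.mem_range.2 hi, Or.inl (Set.mem_biUnion he hω)⟩
      · intro e he f hf hef h3 h4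
        apply hgood
        change ω ∈ bad
        simp only [hbad, Set.mem_iUnion]
        refine ⟨i, Finset.mem_range.2 hi, Or.inr ?_⟩
        have hmem : (e, f) ∈ F.offDiag := Finset.mem_offDiag.2 ⟨he, hf, hef⟩
        exact Set.mem_biUnion (x := (e, f)) hmem ⟨h3, h4⟩
    have hmono : ∀ i, ∀ e ∈ F, N e (timeGrid t n i) ω ≤ N e (timeGrid t n (i + 1)) ω :=
      fun i e he => h1 e he (timeGrid_mono t n (Nat.le_succ i))
    -- after the time `t` the grid is constant
    have hconst : ∀ i, ¬ i < T * 2 ^ n → timeGrid t n (i + 1) = timeGrid t n i := by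
      intro i hi
      rw [timeGrid_of_le hT (by omega), timeGrid_of_le hT (by omega)]
    refine ⟨hmono, ?_, ?_, ?_⟩
    · intro i e he
      by_cases hi : i < T * 2 ^ n
      · have := (hgood' i hi).1 e he
        simp only [hA2, Set.mem_ofPred_eq, not_le] at this
        omega
      · rw [hconst i hi]; exact Nat.le_succ _
    · intro i e he f hf h3 h4
      by_cases hi : i < T * 2 ^ n
      · by_contra hef
        refine (hgood' i hi).2 e he f hf hef ?_ ?_
        · have := hmono i e he
          simp only [hA, Set.mem_ofPred_eq]
          omega
        · have := hmono i f hf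
          simp only [hA, Set.mem_ofPred_eq]
          omega
      · rw [hconst i hi] at h3
        exact absurd rfl h3
    · intro i e he
      unfold gridExtent
      split_ifs
      · exact ⟨(h2 e he _).1.le, (h2 e he _).2⟩
      · norm_num
  have hle : P.real {ω | ¬ GridResolves F (timeGrid t n) (fun e t => N e t ω)
      (fun e k => M e k ω)} ≤ P.real bad :=
    ENNReal.toReal_mono (measure_ne_top _ _) (measure_mono_ae hsub)
  refine hle.trans ((measureReal_biUnion_finset_le _ _).trans ?_)
  refine (Finset.sum_le_card_nsmul _ _ ((F.card + F.card ^ 2) * (lam / 2 ^ n) ^ 2 : ℝ)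
    fun i _ => ?_).trans_eq ?_
  · refine (measureReal_union_le _ _).trans ?_
    rw [add_mul]
    refine add_le_add ?_ ?_
    · refine (measureReal_biUnion_finset_le _ _).trans ?_
      rw [← nsmul_eq_mul]
      exact Finset.sum_le_card_nsmul _ _ _ fun e _ => h.real_two_le_timeGrid_le t n e i
    · refine (measureReal_biUnion_finset_le _ _).trans ?_
      refine (Finset.sum_le_card_nsmul _ _ _ fun p hp =>
        h.real_two_events_timeGrid_le t n (Finset.mem_offDiag.1 hp).2.2 i).trans ?_
      rw [nsmul_eq_mul]
      gcongr
      have h1 : F.offDiag.card ≤ F.card ^ 2 := by rw [Finset.offDiag_card, sq]; omega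
      exact_mod_cast h1
  · rw [Finset.card_range, nsmul_eq_mul]
    push_cast
    ring

/-- With probability close to one, a large enough ball contains all influence on the value at `v` at
time `t`, and a fine enough grid resolves all events in this ball. -/
lemma IsAveragingProcess.exists_good_grid [G.LocallyFinite]
    (h : IsAveragingProcess G lam N M η P)
    (hconn : G.Connected) {D : ℕ} (hdeg : ∀ v, G.degree v ≤ D) (v : V) {t : ℝ≥0} {T : ℕ}
    (hT : t ≤ T) (m₀ : ℕ) {ε : ℝ} (hε : 0 < ε) :
    ∃ m ≥ m₀, ∃ B : Finset V, (∀ x, x ∈ B ↔ G.dist v x ≤ m) ∧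
      ∃ F : Finset G.edgeSet, (∀ e, e ∈ F ↔ ∀ z ∈ (e : Sym2 V), z ∈ B) ∧
      ∃ n, P.real {ω | ¬ (GridResolves F (timeGrid t n) (fun e t => N e t ω)
          (fun e k => M e k ω) ∧ ∀ x ∈ B, m ≤ G.dist v x →
          x ∉ influence (eventEdges F (timeGrid t n) (T * 2 ^ n) fun e t => N e t ω) v
            (T * 2 ^ n))} ≤ ε := by
  obtain ⟨m, hm, hmε⟩ : ∃ m ≥ m₀, Real.exp (2 * D * lam * T) / 2 ^ m ≤ ε / 2 := by
    have hlim : Tendsto (fun m : ℕ => Real.exp (2 * D * lam * T) / 2 ^ m) atTop (𝓝 0) :=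
      tendsto_const_nhds.div_atTop (tendsto_pow_atTop_atTop_of_one_lt (by norm_num))
    obtain ⟨m, h1, h2⟩ := ((hlim.eventually (ge_mem_nhds (half_pos hε))).and
      (eventually_ge_atTop m₀)).exists
    exact ⟨m, h2, h1⟩
  obtain ⟨B, hB⟩ := exists_finset_ball hconn v m
  obtain ⟨F, hF⟩ := exists_finset_edges (G := G) B
  obtain ⟨n, hn⟩ : ∃ n : ℕ, (T : ℝ) * 2 ^ n * ((F.card + F.card ^ 2) * (lam / 2 ^ n) ^ 2) ≤
      ε / 2 := by
    have hlim : Tendsto (fun n : ℕ => (T * (F.card + F.card ^ 2) * lam ^ 2 : ℝ) / 2 ^ n) atTop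
        (𝓝 0) :=
      tendsto_const_nhds.div_atTop (tendsto_pow_atTop_atTop_of_one_lt (by norm_num))
    obtain ⟨n, hn⟩ := (hlim.eventually (ge_mem_nhds (half_pos hε))).exists
    refine ⟨n, le_trans (le_of_eq ?_) hn⟩
    field_simp
  refine ⟨m, hm, B, hB, F, hF, n, ?_⟩
  have hfar : P.real {ω | ∃ x ∈ B, m ≤ G.dist v x ∧ x ∈ influence
      (eventEdges F (timeGrid t n) (T * 2 ^ n) fun e t => N e t ω) v (T * 2 ^ n)} ≤ ε / 2 := by
    refine (h.real_exists_far_influence_le hconn hdeg (timeGrid_mono t n)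
      (q := lam / 2 ^ n) (by positivity) (h.real_event_timeGrid_le t n)
      (fun e he => (hF e).1 he) ((hB v).2 (by simp)) _ m).trans (le_trans ?_ hmε)
    gcongr
    have h1 := Real.add_one_le_exp (2 * D * (lam / 2 ^ n : ℝ))
    calc (1 + 2 * D * (lam / 2 ^ n : ℝ)) ^ (T * 2 ^ n)
        ≤ Real.exp (2 * D * (lam / 2 ^ n : ℝ)) ^ (T * 2 ^ n) :=
          pow_le_pow_left₀ (by positivity) (by linarith) _
      _ = Real.exp (2 * D * lam * T) := by
          rw [← Real.exp_nat_mul]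
          congr 1
          push_cast
          field_simp
  have hsub : {ω | ¬ (GridResolves F (timeGrid t n) (fun e t => N e t ω)
          (fun e k => M e k ω) ∧ ∀ x ∈ B, m ≤ G.dist v x →
          x ∉ influence (eventEdges F (timeGrid t n) (T * 2 ^ n) fun e t => N e t ω) v
            (T * 2 ^ n))} ⊆
      {ω | ¬ GridResolves F (timeGrid t n) (fun e t => N e t ω) (fun e k => M e k ω)} ∪
      {ω | ∃ x ∈ B, m ≤ G.dist v x ∧ x ∈ influence
        (eventEdges F (timeGrid t n) (T * 2 ^ n) fun e t => N e t ω) v (T * 2 ^ n)} := by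
    intro ω hω
    simp only [Set.mem_ofPred_eq, not_and_or, not_forall, not_not] at hω
    rcases hω with hω | ⟨x, hx, hm, hxi⟩
    · exact Or.inl hω
    · exact Or.inr ⟨x, hx, hm, hxi⟩
  refine (measureReal_mono hsub).trans ((measureReal_union_le _ _).trans ?_)
  have := (h.real_not_gridResolves_le F hT n).trans hn
  linarith

end FineGrid

/-! ### Measurability in the environment of clocks and extents -/

section Environment

lemma measurable_countable_index {α ι β : Type*} [MeasurableSpace α] [MeasurableSpace β]
    [MeasurableSpace ι] [Countable ι] [MeasurableSingletonClass ι] {f : ι → α → β} {X : α → ι}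
    (hf : ∀ i, Measurable (f i)) (hX : Measurable X) : Measurable fun a => f (X a) a :=
  (measurable_from_prod_countable_right (f := fun q : ι × α => f q.1 q.2) hf).comp
    (hX.prodMk measurable_id)

variable {V : Type*} {G : SimpleGraph V} (F : Finset G.edgeSet) (s : ℕ → ℝ≥0)

/-- The values of all the clocks together with all the extents of the updates. -/
abbrev Environment (G : SimpleGraph V) : Type _ :=
  (G.edgeSet → ℝ≥0 → ℕ) × (G.edgeSet → ℕ → ℝ)

lemma measurable_clock (e : G.edgeSet) (t : ℝ≥0) :
    Measurable fun ν : Environment G => ν.1 e t :=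
  (measurable_pi_apply t).comp ((measurable_pi_apply e).comp measurable_fst)

lemma measurable_extent (e : G.edgeSet) (k : ℕ) :
    Measurable fun ν : Environment G => ν.2 e k :=
  (measurable_pi_apply k).comp ((measurable_pi_apply e).comp measurable_snd)

lemma measurable_sum_extent (e : G.edgeSet) (a b : ℝ≥0) :
    Measurable fun ν : Environment G => ∑ k ∈ Finset.Ico (ν.1 e a) (ν.1 e b), ν.2 e k :=
  measurable_countable_index (X := fun ν : Environment G => (ν.1 e a, ν.1 e b))
    (f := fun i ν => ∑ k ∈ Finset.Ico i.1 i.2, ν.2 e k)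
    (fun _ => Finset.measurable_sum _ fun k _ => measurable_extent e k)
    ((measurable_clock e a).prodMk (measurable_clock e b))

lemma measurable_gridExtent (i : ℕ) (e : G.edgeSet) :
    Measurable fun ν : Environment G => gridExtent F s ν.1 ν.2 i e := by
  classical
  refine Measurable.ite ?_ (measurable_countable_index (X := fun ν : Environment G => ν.1 e (s i))
    (f := fun k ν => ν.2 e k) (fun k => measurable_extent e k) (measurable_clock e _))
    measurable_const
  refine (MeasurableSet.const (e ∈ F)).inter ?_
  exact (measurableSet_eq_fun (measurable_clock e _) (measurable_clock e _)).compl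

lemma measurable_gridRun (p : V → ℝ) (i : ℕ) (z : V) :
    Measurable fun ν : Environment G => gridRun F (gridExtent F s ν.1 ν.2) p i z := by
  induction i generalizing z with
  | zero => exact measurable_const
  | succ i ih =>
    exact (ih z).add (Finset.measurable_sum _ fun e _ =>
      (measurable_gridExtent F s i e).mul ((ih _).sub (ih z)))

lemma measurableSet_gridResolves :
    MeasurableSet {ν : Environment G | GridResolves F s ν.1 ν.2} := by
  have heq : {ν : Environment G | GridResolves F s ν.1 ν.2} =
      ⋂ i, ((⋂ e ∈ F, {ν : Environment G | ν.1 e (s i) ≤ ν.1 e (s (i + 1))}) ∩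
        (⋂ e ∈ F, {ν : Environment G | ν.1 e (s (i + 1)) ≤ ν.1 e (s i) + 1}) ∩
        (⋂ e ∈ F, ⋂ f ∈ F, ({ν : Environment G | ν.1 e (s (i + 1)) = ν.1 e (s i)} ∪
          {ν : Environment G | ν.1 f (s (i + 1)) = ν.1 f (s i)} ∪ {_ν | e = f})) ∩
        ⋂ e ∈ F, {ν : Environment G | gridExtent F s ν.1 ν.2 i e ∈ Set.Icc (0 : ℝ) (1 / 2)}) := by
    ext ν
    simp only [Set.mem_iInter, Set.mem_inter_iff, Set.mem_union, Set.mem_ofPred_eq]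
    constructor
    · intro h i
      refine ⟨⟨⟨h.mono i, h.unit i⟩, fun e he f hf => ?_⟩, h.extent i⟩
      by_cases h1 : ν.1 e (s (i + 1)) = ν.1 e (s i)
      · exact Or.inl (Or.inl h1)
      by_cases h2 : ν.1 f (s (i + 1)) = ν.1 f (s i)
      · exact Or.inl (Or.inr h2)
      exact Or.inr (h.exclusive i e he f hf h1 h2)
    · intro h
      refine ⟨fun i => (h i).1.1.1, fun i => (h i).1.1.2, fun i e he f hf h1 h2 => ?_,
        fun i => (h i).2⟩
      rcases (h i).1.2 e he f hf with (h3 | h3) | h3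
      · exact absurd h3 h1
      · exact absurd h3 h2
      · exact h3
  rw [heq]
  refine MeasurableSet.iInter fun i => (((?_ : MeasurableSet _).inter ?_).inter ?_).inter ?_
  · exact F.measurableSet_biInter fun e _ =>
      measurableSet_le (measurable_clock e _) (measurable_clock e _)
  · exact F.measurableSet_biInter fun e _ =>
      measurableSet_le (measurable_clock e _) ((measurable_clock e _).add measurable_const)
  · exact F.measurableSet_biInter fun e _ => F.measurableSet_biInter fun f _ =>
      ((measurableSet_eq_fun (measurable_clock e _) (measurable_clock e _)).union
        (measurableSet_eq_fun (measurable_clock f _) (measurable_clock f _))).union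
        (MeasurableSet.const _)
  · exact F.measurableSet_biInter fun e _ => measurable_gridExtent F s i e measurableSet_Icc

lemma measurableSet_mem_influence_environment (K j : ℕ) (v x : V) :
    MeasurableSet {ν : Environment G | x ∈ influence (eventEdges F s K ν.1) v j} := by
  refine measurableSet_mem_influence (F := F) (fun ω i e he => he.1) (fun i _ e _ => ?_) x
  exact (MeasurableSet.const (e ∈ F)).inter
    (((measurable_clock e _).sub (measurable_clock e _))
      (MeasurableSet.of_discrete (s := {k : ℕ | k ≠ 0})))

/-- The grid resolves the dynamics on `F`, and the influence on `v` stays within distance less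
than `m`. -/
def goodEnvironments (B : Finset V) (v : V) (m K : ℕ) : Set (Environment G) :=
  {ν | GridResolves F s ν.1 ν.2 ∧
    ∀ x ∈ B, m ≤ G.dist v x → x ∉ influence (eventEdges F s K ν.1) v K}

lemma measurableSet_goodEnvironments (B : Finset V) (v : V) (m K : ℕ) :
    MeasurableSet (goodEnvironments F s B v m K) := by
  have heq : {ν : Environment G | ∀ x ∈ B, m ≤ G.dist v x →
      x ∉ influence (eventEdges F s K ν.1) v K} =
      ⋂ x ∈ B, ({_ν | ¬ m ≤ G.dist v x} ∪
        {ν : Environment G | x ∈ influence (eventEdges F s K ν.1) v K}ᶜ) := by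
    ext ν
    simp only [Set.mem_iInter, Set.mem_union, Set.mem_ofPred_eq, Set.mem_compl_iff]
    exact forall₂_congr fun x _ => by tauto
  have hfar : MeasurableSet {ν : Environment G | ∀ x ∈ B, m ≤ G.dist v x →
      x ∉ influence (eventEdges F s K ν.1) v K} := by
    rw [heq]
    exact B.measurableSet_biInter fun x _ => (MeasurableSet.const _).union
      (measurableSet_mem_influence_environment F s K K v x).compl
  exact (measurableSet_gridResolves F s).inter hfar

/-- Each edge in `F` receives a total weight of at least one during each of the first `q` of the
time windows `(T j, T (j + 1)]`. -/
def busyEnvironments (q : ℕ) (T : ℕ → ℕ) : Set (Environment G) :=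
  {ν | ∀ j < q, ∀ e ∈ F, 1 ≤ ∑ k ∈ Finset.Ico (ν.1 e (T j)) (ν.1 e (T (j + 1))), ν.2 e k}

lemma measurableSet_busyEnvironments (q : ℕ) (T : ℕ → ℕ) :
    MeasurableSet (busyEnvironments F q T) := by
  have heq : busyEnvironments F q T = ⋂ j ∈ Finset.range q, ⋂ e ∈ F, {ν : Environment G |
      1 ≤ ∑ k ∈ Finset.Ico (ν.1 e (T j)) (ν.1 e (T (j + 1))), ν.2 e k} := by
    ext ν
    simp [busyEnvironments]
  rw [heq]
  exact (Finset.range q).measurableSet_biInter fun j _ => F.measurableSet_biInter fun e _ =>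
    measurableSet_le measurable_const (measurable_sum_extent e _ _)

end Environment

/-! ### Time windows in which every edge of a finite set is busy -/

section Windows

variable {V Ω : Type*} [MeasurableSpace Ω] {P : Measure Ω} [IsProbabilityMeasure P]
  {G : SimpleGraph V} {lam : ℝ≥0} {N : G.edgeSet → ℝ≥0 → Ω → ℕ}
  {M : G.edgeSet → ℕ → Ω → ℝ} {η : ℝ≥0 → V → Ω → ℝ}

/-- The environment at the sample point `ω`. -/
def environment (N : G.edgeSet → ℝ≥0 → Ω → ℕ) (M : G.edgeSet → ℕ → Ω → ℝ) (ω : Ω) :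
    Environment G :=
  (fun e t => N e t ω, fun e k => M e k ω)

omit [IsProbabilityMeasure P] in
lemma IsAveragingProcess.measurable_environment (h : IsAveragingProcess G lam N M η P) :
    Measurable (environment N M) :=
  (measurable_pi_lambda _ fun e => measurable_pi_lambda _ fun t =>
    (h.poisson e).measurable t).prodMk
  (measurable_pi_lambda _ fun e => measurable_pi_lambda _ fun k => h.measurable_extent e k)

lemma IsAveragingProcess.exists_busy_window (h : IsAveragingProcess G lam N M η P)
    (hlam : 0 < lam) (hM : ∀ e, ∀ᵐ ω ∂P, ¬ Summable fun k => M e k ω) (F : Finset G.edgeSet)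
    (a : ℕ) {ε : ℝ} (hε : 0 < ε) :
    ∃ b, a ≤ b ∧ P.real {ω | ¬ ∀ e ∈ F,
      1 ≤ ∑ k ∈ Finset.Ico (N e a ω) (N e b ω), M e k ω} ≤ ε := by
  set A : ℕ → Set Ω := fun b => {ω | ¬ ∀ e ∈ F,
      1 ≤ ∑ k ∈ Finset.Ico (N e a ω) (N e b ω), M e k ω} with hA
  have hAm : ∀ b, MeasurableSet (A b) := by
    intro b
    have heq : A b = (⋂ e ∈ F, environment N M ⁻¹' {ν : Environment G |
        1 ≤ ∑ k ∈ Finset.Ico (ν.1 e a) (ν.1 e b), ν.2 e k})ᶜ := by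
      ext ω
      simp only [hA, Set.mem_compl_iff, Set.mem_iInter, Set.mem_ofPred_eq]
      rfl
    rw [heq]
    exact (F.measurableSet_biInter fun e _ => h.measurable_environment
      (measurableSet_le measurable_const (measurable_sum_extent e _ _))).compl
  have hlim : Tendsto (fun b => P (A b)) atTop (𝓝 (P ∅)) := by
    refine tendsto_measure_of_ae_tendsto_indicator_of_isFiniteMeasure atTop MeasurableSet.empty
      hAm ?_
    have h1 : ∀ᵐ ω ∂P, ∀ e ∈ F, Tendsto (fun b : ℕ => N e b ω) atTop atTop :=
      (Finset.eventually_all F).2 fun e _ => (h.poisson e).ae_tendsto_atTop hlam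
    have h2 : ∀ᵐ ω ∂P, ∀ e ∈ F, ∀ k, M e k ω ∈ Set.Ioc (0 : ℝ) (1 / 2) :=
      (Finset.eventually_all F).2 fun e _ => ae_all_iff.2 fun k => h.extent_mem e k
    have h3 : ∀ᵐ ω ∂P, ∀ e ∈ F, ¬ Summable fun k => M e k ω :=
      (Finset.eventually_all F).2 fun e _ => hM e
    filter_upwards [h1, h2, h3] with ω h1 h2 h3
    have hev : ∀ e ∈ F, ∀ᶠ b : ℕ in atTop,
        1 ≤ ∑ k ∈ Finset.Ico (N e a ω) (N e b ω), M e k ω := by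
      intro e he
      have h4 := ((not_summable_iff_tendsto_nat_atTop_of_nonneg
        fun k => (h2 e he k).1.le).1 (h3 e he)).comp (h1 e he)
      filter_upwards [h4.eventually_ge_atTop (1 + ∑ k ∈ Finset.range (N e a ω), M e k ω),
        (h1 e he).eventually_ge_atTop (N e a ω)] with b h5 h6
      rw [Finset.sum_Ico_eq_sub _ h6]
      simp only [Function.comp] at h5
      linarith
    filter_upwards [(Finset.eventually_all F).2 hev] with b hb
    simp only [Set.mem_empty_iff_false, iff_false]
    exact fun hω => hω hb
  rw [measure_empty] at hlim
  have hev := hlim.eventually (ge_mem_nhds (ENNReal.ofReal_pos.2 hε))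
  obtain ⟨b, hb, hab⟩ := (hev.and (eventually_ge_atTop a)).exists
  exact ⟨b, hab, ENNReal.toReal_le_of_le_ofReal hε.le hb⟩

lemma IsAveragingProcess.exists_busy_windows (h : IsAveragingProcess G lam N M η P)
    (hlam : 0 < lam) (hM : ∀ e, ∀ᵐ ω ∂P, ¬ Summable fun k => M e k ω) (F : Finset G.edgeSet)
    (q : ℕ) {ε : ℝ} (hε : 0 < ε) :
    ∃ T : ℕ → ℕ, Monotone T ∧
      P.real (environment N M ⁻¹' (busyEnvironments F q T)ᶜ) ≤ ε := by
  have hq : 0 < ε / (q + 1) := by positivity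
  choose f hf1 hf2 using fun a => h.exists_busy_window hlam hM F a hq
  set T : ℕ → ℕ := fun j => f^[j] 0 with hT
  have hTs : ∀ j, T (j + 1) = f (T j) := fun j => Function.iterate_succ_apply' f j 0
  refine ⟨T, monotone_nat_of_le_succ fun j => by rw [hTs]; exact hf1 _, ?_⟩
  have hsub : environment N M ⁻¹' (busyEnvironments F q T)ᶜ ⊆
      ⋃ j ∈ Finset.range q, {ω | ¬ ∀ e ∈ F,
        1 ≤ ∑ k ∈ Finset.Ico (N e (T j) ω) (N e (f (T j)) ω), M e k ω} := by
    intro ω hω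
    by_contra hcon
    simp only [Set.mem_iUnion, not_exists, Finset.mem_range] at hcon
    refine hω fun j hj e he => ?_
    rw [hTs]
    exact not_not.1 (hcon j hj) e he
  refine (measureReal_mono hsub (measure_ne_top _ _)).trans
    ((measureReal_biUnion_finset_le _ _).trans ?_)
  refine (Finset.sum_le_card_nsmul _ _ _ fun j _ => hf2 (T j)).trans ?_
  rw [Finset.card_range, nsmul_eq_mul, mul_div_assoc', div_le_iff₀ (by positivity)]
  nlinarith

end Windows

/-! ### Second moments -/

section SecondMoment

variable {V Ω E : Type*} [MeasurableSpace Ω] [MeasurableSpace E] {P : Measure Ω}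
  [IsProbabilityMeasure P]

/-- The second moment of a linear combination of centred independent variables with random bounded
coefficients that are independent of them. -/
lemma integral_sq_sum_mul {X : Ω → E} (hX : Measurable X) {Z : V → Ω → ℝ}
    (hind : IndepFun X (fun ω v => Z v ω) P) (hZm : ∀ v, Measurable (Z v))
    (hZ : ∀ v, MemLp (Z v) 2 P) (h0 : ∀ v, ∫ ω, Z v ω ∂P = 0)
    (hpair : ∀ u w, u ≠ w → IndepFun (Z u) (Z w) P) {σ2 : ℝ} (hσ : ∀ v, ∫ ω, Z v ω ^ 2 ∂P = σ2)
    {g : V → E → ℝ} (hg : ∀ v, Measurable (g v)) (hb : ∀ v x, |g v x| ≤ 1) (B : Finset V) :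
    Integrable (fun ω => (∑ u ∈ B, g u (X ω) * Z u ω) ^ 2) P ∧
      ∫ ω, (∑ u ∈ B, g u (X ω) * Z u ω) ^ 2 ∂P = σ2 * ∫ ω, ∑ u ∈ B, g u (X ω) ^ 2 ∂P := by
  have hexp : (fun ω => (∑ u ∈ B, g u (X ω) * Z u ω) ^ 2) =
      fun ω => ∑ u ∈ B, ∑ w ∈ B, (g u (X ω) * g w (X ω)) * (Z u ω * Z w ω) := by
    funext ω
    rw [sq, Finset.sum_mul_sum]
    exact Finset.sum_congr rfl fun u _ => Finset.sum_congr rfl fun w _ => by ring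
  have hgm : ∀ u w, Measurable fun ω => g u (X ω) * g w (X ω) := fun u w =>
    ((hg u).comp hX).mul ((hg w).comp hX)
  have hgb : ∀ u w x, |g u x * g w x| ≤ 1 := by
    intro u w x
    rw [abs_mul]
    exact mul_le_one₀ (hb u x) (abs_nonneg _) (hb w x)
  have hint : ∀ u w, Integrable (fun ω => (g u (X ω) * g w (X ω)) * (Z u ω * Z w ω)) P := by
    intro u w
    exact ((hZ u).integrable_mul (hZ w)).bdd_mul (c := 1) (hgm u w).aestronglyMeasurable
      (Eventually.of_forall fun ω => by rw [Real.norm_eq_abs]; exact hgb u w (X ω))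
  have hterm : ∀ u w, ∫ ω, (g u (X ω) * g w (X ω)) * (Z u ω * Z w ω) ∂P =
      (∫ ω, g u (X ω) * g w (X ω) ∂P) * ∫ ω, Z u ω * Z w ω ∂P := by
    intro u w
    have hcomp := hind.comp ((hg u).mul (hg w))
      ((measurable_pi_apply u).mul (measurable_pi_apply w) :
        Measurable fun z : V → ℝ => z u * z w)
    exact hcomp.integral_fun_mul_eq_mul_integral (hgm u w).aestronglyMeasurable
      ((hZm u).mul (hZm w)).aestronglyMeasurable
  have hcov : ∀ u w, u ≠ w → ∫ ω, Z u ω * Z w ω ∂P = 0 := by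
    intro u w huw
    rw [(hpair u w huw).integral_fun_mul_eq_mul_integral (hZm u).aestronglyMeasurable
      (hZm w).aestronglyMeasurable, h0 u, zero_mul]
  rw [hexp]
  refine ⟨integrable_finsetSum _ fun u _ => integrable_finsetSum _ fun w _ => hint u w, ?_⟩
  rw [integral_finsetSum _ fun u _ => integrable_finsetSum _ fun w _ => hint u w,
    integral_finsetSum, Finset.mul_sum]
  · refine Finset.sum_congr rfl fun u hu => ?_
    rw [integral_finsetSum _ fun w _ => hint u w, Finset.sum_eq_single_of_mem u hu]
    · rw [hterm, mul_comm]
      simp only [← sq, hσ]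
    · intro w _ hwu
      rw [hterm, hcov u w hwu.symm, mul_zero]
  · intro u _
    refine Integrable.of_bound (C := 1) (((hg u).comp hX).pow_const 2).aestronglyMeasurable
      (Eventually.of_forall fun ω => ?_)
    rw [Real.norm_eq_abs, sq]
    exact hgb u u (X ω)

/-- A nonnegative function whose integral over sets of almost full measure is at most `C` has
integral at most `C`. -/
lemma lintegral_le_of_forall_exists {f : Ω → ℝ≥0∞} (hf : Measurable f) {C : ℝ≥0∞}
    (h : ∀ ε : ℝ, 0 < ε → ∃ A, MeasurableSet A ∧ P.real Aᶜ ≤ ε ∧ ∫⁻ ω in A, f ω ∂P ≤ C) :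
    ∫⁻ ω, f ω ∂P ≤ C := by
  have htrunc : ∀ L : ℕ, ∫⁻ ω, min (f ω) L ∂P ≤ C := by
    intro L
    refine ENNReal.le_of_forall_pos_le_add fun δ hδ _ => ?_
    have hε : (0 : ℝ) < δ / (L + 1) := by positivity
    obtain ⟨A, hA, hAc, hAf⟩ := h _ hε
    rw [← lintegral_add_compl _ hA]
    refine add_le_add ((lintegral_mono fun ω => min_le_left _ _).trans hAf) ?_
    calc ∫⁻ ω in Aᶜ, min (f ω) L ∂P ≤ ∫⁻ _ω in Aᶜ, (L : ℝ≥0∞) ∂P :=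
          lintegral_mono fun ω => min_le_right _ _
      _ = L * P Aᶜ := setLIntegral_const _ _
      _ ≤ L * ENNReal.ofReal (δ / (L + 1)) := by
          gcongr
          rw [← ofReal_measureReal]
          exact ENNReal.ofReal_le_ofReal hAc
      _ = ENNReal.ofReal (L * (δ / (L + 1))) := by
          rw [ENNReal.ofReal_mul (by positivity), ENNReal.ofReal_natCast]
      _ ≤ ENNReal.ofReal δ := by
          apply ENNReal.ofReal_le_ofReal
          rw [mul_div_assoc', div_le_iff₀ (by positivity)]
          nlinarith [δ.2]
      _ = δ := ENNReal.ofReal_coe_nnreal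
  have hsup : ∀ ω, f ω = ⨆ L : ℕ, min (f ω) L := by
    intro ω
    rw [← inf_iSup_eq, ENNReal.iSup_natCast, inf_top_eq]
  rw [lintegral_congr hsup, lintegral_iSup (fun L => hf.min measurable_const)]
  · exact iSup_le htrunc
  · intro a b hab ω
    exact min_le_min le_rfl (by exact_mod_cast hab)

end SecondMoment

/-! ### The variance of the averaging process -/

section Variance

variable {V Ω : Type*} [MeasurableSpace Ω] {P : Measure Ω} [IsProbabilityMeasure P]
  {G : SimpleGraph V} [G.LocallyFinite] {lam : ℝ≥0} {N : G.edgeSet → ℝ≥0 → Ω → ℕ}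
  {M : G.edgeSet → ℕ → Ω → ℝ} {η : ℝ≥0 → V → Ω → ℝ}

/-- If, whatever the good grid and up to an exceptional set of environments, the value at `v` at
time `t` depends on no single initial value with a weight above `c`, then its second central moment
is at most `c`, plus the probability of the exceptional set, times the initial variance. -/
lemma IsAveragingProcess.lintegral_sub_sq_le (h : IsAveragingProcess G lam N M η P)
    (hconn : G.Connected) {D : ℕ} (hdeg : ∀ v, G.degree v ≤ D)
    (hindep : iIndepFun (fun v => η 0 v) P) (hL2 : ∀ v, MemLp (η 0 v) 2 P) {m₁ σ2 : ℝ}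
    (hm₁ : ∀ v, ∫ ω, η 0 v ω ∂P = m₁) (hσ : ∀ v, ∫ ω, (η 0 v ω - m₁) ^ 2 ∂P = σ2) (v : V)
    {t : ℝ≥0} {T : ℕ} (hT : t ≤ T) {W : Set (Environment G)} (hW : MeasurableSet W) {c : ℝ}
    (hc : 0 ≤ c) (m₀ : ℕ)
    (hsmall : ∀ m ≥ m₀, ∀ (B : Finset V) (F : Finset G.edgeSet) (n : ℕ),
      (∀ x, x ∈ B ↔ G.dist v x ≤ m) → (∀ e, e ∈ F ↔ ∀ z ∈ (e : Sym2 V), z ∈ B) →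
      ∀ ν ∈ W, GridResolves F (timeGrid t n) ν.1 ν.2 → ∀ [DecidableEq V], ∀ u ∈ B,
        gridRun F (gridExtent F (timeGrid t n) ν.1 ν.2) (Pi.single u 1) (T * 2 ^ n) v ≤ c) :
    ∫⁻ ω, ‖η t v ω - m₁‖ₑ ^ 2 ∂P ≤
      ENNReal.ofReal (σ2 * (c + P.real (environment N M ⁻¹' Wᶜ))) := by
  classical
  refine lintegral_le_of_forall_exists (((h.measurable_value t v).sub_const m₁).enorm.pow_const 2)
    fun ε hε => ?_
  obtain ⟨m, hm, B, hB, F, hF, n, hbad⟩ := h.exists_good_grid hconn hdeg v hT m₀ hε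
  set K := T * 2 ^ n with hK
  set good : Set (Environment G) := goodEnvironments F (timeGrid t n) B v m K with hgood
  have hgm : MeasurableSet good := measurableSet_goodEnvironments F _ B v m K
  refine ⟨environment N M ⁻¹' good, h.measurable_environment hgm, hbad, ?_⟩
  have hFB : ∀ e ∈ F, ∀ z ∈ (e : Sym2 V), z ∈ B := fun e he => (hF e).1 he
  have hvB : v ∈ B := (hB v).2 (by simp)
  set ξ : V → Environment G → ℝ := fun u ν =>
    gridRun F (gridExtent F (timeGrid t n) ν.1 ν.2) (Pi.single u 1) K v with hξ
  have hξ0 : ∀ ν ∈ good, ∀ u ∈ B, 0 ≤ ξ u ν := fun ν hν u hu =>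
    (hν.1.isAveragingRun hFB u hu).nonneg K v
  have hξ1 : ∀ ν, ∑ u ∈ B, ξ u ν = 1 := fun ν => sum_gridRun_single hFB _ K hvB
  have hξle : ∀ ν ∈ good, ∀ u ∈ B, ξ u ν ≤ 1 := fun ν hν u hu =>
    (Finset.single_le_sum (fun w hw => hξ0 ν hν w hw) hu).trans_eq (hξ1 ν)
  set g : V → Environment G → ℝ := fun u ν => if u ∈ B then good.indicator (ξ u) ν else 0 with hg
  have hgmeas : ∀ u, Measurable (g u) := by
    intro u
    by_cases hu : u ∈ B
    · simp only [hg, hu, if_true]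
      exact (measurable_gridRun F _ _ K v).indicator hgm
    · simp only [hg, hu, if_false]
      exact measurable_const
  have hgb : ∀ u ν, |g u ν| ≤ 1 := by
    intro u ν
    by_cases hu : u ∈ B
    · by_cases hν : ν ∈ good
      · simp only [hg, hu, if_true, Set.indicator_of_mem hν]
        rw [abs_of_nonneg (hξ0 ν hν u hu)]
        exact hξle ν hν u hu
      · simp [hg, hu, Set.indicator_of_notMem hν]
    · simp [hg, hu]
  set Z : V → Ω → ℝ := fun u ω => η 0 u ω - m₁ with hZ
  have hZm : ∀ u, Measurable (Z u) := fun u => (h.measurable_value 0 u).sub_const m₁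
  have hZind : IndepFun (environment N M) (fun ω u => Z u ω) P :=
    h.indep_initial.comp (φ := id) (ψ := fun (x : V → ℝ) u => x u - m₁) measurable_id
      (by fun_prop)
  have hZ2 : ∀ u, MemLp (Z u) 2 P := fun u => (hL2 u).sub (memLp_const m₁)
  have hZ0 : ∀ u, ∫ ω, Z u ω ∂P = 0 := by
    intro u
    simp only [hZ]
    rw [integral_sub ((hL2 u).integrable (by norm_num)) (integrable_const _), hm₁ u]
    simp
  have hZpair : ∀ u w, u ≠ w → IndepFun (Z u) (Z w) P := fun u w huw =>
    (hindep.indepFun huw).comp (measurable_id.sub_const m₁) (measurable_id.sub_const m₁)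
  obtain ⟨hYint, hYeq⟩ := integral_sq_sum_mul h.measurable_environment hZind hZm hZ2 hZ0 hZpair hσ
    hgmeas hgb B
  -- on the good event the value is an average of the initial values
  have hrepr : ∀ᵐ ω ∂P, environment N M ω ∈ good →
      η t v ω - m₁ = ∑ u ∈ B, g u (environment N M ω) * Z u ω := by
    filter_upwards [h.trajectory] with ω hω hgo
    have hinf : influence (eventEdges F (timeGrid t n) K fun e t => N e t ω) v K ⊆
        {x | G.dist v x < m} := by
      -- the influence set stays inside the ball, hence strictly inside by goodness
      have hin : ∀ j, influence (eventEdges F (timeGrid t n) K fun e t => N e t ω) v j ⊆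
          (B : Set V) := by
        intro j
        induction j with
        | zero => rintro x rfl; exact hvB
        | succ j ih =>
          rintro x (hx | ⟨e, he, hx⟩)
          · exact ih hx
          · by_cases hxe : x ∈ (e : Sym2 V)
            · exact hFB e he.1 x hxe
            · rw [otherEnd_of_notMem hxe] at hx
              exact ih hx
      intro x hx
      by_contra hxm
      exact hgo.2 x (hin K hx) (not_lt.1 hxm) hx
    have hFinc : ∀ e : G.edgeSet, ∀ z ∈ (e : Sym2 V), z ∈ {x | G.dist v x < m} → e ∈ F := by
      intro e z hz hzm
      refine (hF e).2 fun y hy => (hB y).2 ?_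
      have hzm' : G.dist v z < m := hzm
      rw [mk_otherEnd hz, Sym2.mem_iff] at hy
      rcases hy with rfl | rfl
      · exact hzm'.le
      · have h1 := e.2
        rw [mk_otherEnd hz, SimpleGraph.mem_edgeSet] at h1
        have h2 := hconn.dist_triangle (u := v) (v := z) (w := otherEnd (e : Sym2 V) z)
        rw [SimpleGraph.dist_eq_one_iff_adj.2 h1] at h2
        omega
    have hrun := hgo.1.gridRun_eq (timeGrid_mono t n) hω hinf hFinc K le_rfl v
      (by rw [Nat.sub_self]; exact rfl)
    rw [timeGrid_of_le hT (by rw [hK]), timeGrid_zero,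
      gridRun_eq_sum hFB _ _ K hvB] at hrun
    rw [hrun]
    have hone := hξ1 (environment N M ω)
    calc _ = ∑ u ∈ B, ξ u (environment N M ω) * η 0 u ω -
          (∑ u ∈ B, ξ u (environment N M ω)) * m₁ := by rw [hone, one_mul]
      _ = ∑ u ∈ B, g u (environment N M ω) * Z u ω := by
          rw [Finset.sum_mul, ← Finset.sum_sub_distrib]
          refine Finset.sum_congr rfl fun u hu => ?_
          simp only [hg, hu, if_true, Set.indicator_of_mem hgo, hZ]
          ring
  have hσ0 : 0 ≤ σ2 := by rw [← hσ v]; exact integral_nonneg fun ω => sq_nonneg _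
  calc ∫⁻ ω in environment N M ⁻¹' good, ‖η t v ω - m₁‖ₑ ^ 2 ∂P
      = ∫⁻ ω in environment N M ⁻¹' good,
          ENNReal.ofReal ((∑ u ∈ B, g u (environment N M ω) * Z u ω) ^ 2) ∂P := by
        refine setLIntegral_congr_fun_ae (h.measurable_environment hgm) ?_
        filter_upwards [hrepr] with ω hω hgo
        rw [hω hgo, ← sq_abs, ENNReal.ofReal_pow (abs_nonneg _), Real.enorm_eq_ofReal_abs]
    _ ≤ ∫⁻ ω, ENNReal.ofReal ((∑ u ∈ B, g u (environment N M ω) * Z u ω) ^ 2) ∂P :=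
        setLIntegral_le_lintegral _ _
    _ = ENNReal.ofReal (∫ ω, (∑ u ∈ B, g u (environment N M ω) * Z u ω) ^ 2 ∂P) :=
        (ofReal_integral_eq_lintegral_ofReal hYint (Eventually.of_forall fun ω => sq_nonneg _)).symm
    _ ≤ ENNReal.ofReal (σ2 * (c + P.real (environment N M ⁻¹' Wᶜ))) := by
        rw [hYeq]
        refine ENNReal.ofReal_le_ofReal (mul_le_mul_of_nonneg_left ?_ hσ0)
        have hWm : MeasurableSet (environment N M ⁻¹' Wᶜ) := h.measurable_environment hW.compl
        have hbound : ∀ ω, ∑ u ∈ B, g u (environment N M ω) ^ 2 ≤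
            c + (environment N M ⁻¹' Wᶜ).indicator (fun _ => (1 : ℝ)) ω := by
          intro ω
          by_cases hgo : environment N M ω ∈ good
          · have hsq : ∀ b : ℝ, (∀ u ∈ B, ξ u (environment N M ω) ≤ b) →
                ∑ u ∈ B, g u (environment N M ω) ^ 2 ≤ b := by
              intro b hb
              calc ∑ u ∈ B, g u (environment N M ω) ^ 2
                  ≤ ∑ u ∈ B, b * ξ u (environment N M ω) := by
                    refine Finset.sum_le_sum fun u hu => ?_
                    simp only [hg, hu, if_true, Set.indicator_of_mem hgo]
                    rw [sq]
                    exact mul_le_mul_of_nonneg_right (hb u hu) (hξ0 _ hgo u hu)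
                _ = b := by rw [← Finset.mul_sum, hξ1, mul_one]
            by_cases hωW : environment N M ω ∈ W
            · rw [Set.indicator_of_notMem
                (show ω ∉ environment N M ⁻¹' Wᶜ from fun hn => hn hωW), add_zero]
              exact hsq c fun u hu => hsmall m hm B F n hB hF _ hωW hgo.1 u hu
            · rw [Set.indicator_of_mem (show ω ∈ environment N M ⁻¹' Wᶜ from hωW)]
              have := hsq 1 (hξle _ hgo)
              linarith
          · have hzero : ∑ u ∈ B, g u (environment N M ω) ^ 2 = 0 := by
              refine Finset.sum_eq_zero fun u hu => ?_
              simp [hg, hu, Set.indicator_of_notMem hgo]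
            rw [hzero]
            have : 0 ≤ (environment N M ⁻¹' Wᶜ).indicator (fun _ => (1 : ℝ)) ω :=
              Set.indicator_nonneg (fun _ _ => zero_le_one) ω
            linarith
        have hI : Integrable (fun ω => c + (environment N M ⁻¹' Wᶜ).indicator
            (fun _ => (1 : ℝ)) ω) P :=
          (integrable_const c).add ((integrable_const (1 : ℝ)).indicator hWm)
        calc ∫ ω, ∑ u ∈ B, g u (environment N M ω) ^ 2 ∂P
            ≤ ∫ ω, c + (environment N M ⁻¹' Wᶜ).indicator (fun _ => (1 : ℝ)) ω ∂P :=
              integral_mono_of_nonneg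
                (Eventually.of_forall fun ω => Finset.sum_nonneg fun u _ => sq_nonneg _) hI
                (Eventually.of_forall hbound)
          _ = c + P.real (environment N M ⁻¹' Wᶜ) := by
              rw [integral_add (integrable_const c) ((integrable_const (1 : ℝ)).indicator hWm),
                integral_indicator_const _ hWm]
              simp

/-- At every late enough time the second central moment is at most `2 * c` times the initial
variance. -/
lemma IsAveragingProcess.eventually_lintegral_sub_sq_le [Infinite V]
    (h : IsAveragingProcess G lam N M η P) (hlam : 0 < lam)
    (hM : ∀ e, ∀ᵐ ω ∂P, ¬ Summable fun k => M e k ω)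
    (hconn : G.Connected) {D : ℕ} (hdeg : ∀ v, G.degree v ≤ D)
    (hindep : iIndepFun (fun v => η 0 v) P) (hL2 : ∀ v, MemLp (η 0 v) 2 P) {m₁ σ2 : ℝ}
    (hm₁ : ∀ v, ∫ ω, η 0 v ω ∂P = m₁) (hσ : ∀ v, ∫ ω, (η 0 v ω - m₁) ^ 2 ∂P = σ2) (v : V)
    {c : ℝ} (hc : 0 < c) :
    ∀ᶠ t : ℝ≥0 in atTop, ∫⁻ ω, ‖η t v ω - m₁‖ₑ ^ 2 ∂P ≤ ENNReal.ofReal (σ2 * (2 * c)) := by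
  obtain ⟨R, q, hdecay⟩ := exists_windows_decay hconn hc
  obtain ⟨B₀, hB₀⟩ := exists_finset_ball hconn v (R + 1)
  obtain ⟨F₀, hF₀⟩ := exists_finset_edges (G := G) B₀
  obtain ⟨T, hTmono, hT⟩ := h.exists_busy_windows hlam hM F₀ q hc
  filter_upwards [eventually_ge_atTop (T q : ℝ≥0)] with t ht
  have hσ0 : 0 ≤ σ2 := by rw [← hσ v]; exact integral_nonneg fun ω => sq_nonneg _
  refine (h.lintegral_sub_sq_le hconn hdeg hindep hL2 hm₁ hσ v (Nat.le_ceil t)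
    (measurableSet_busyEnvironments F₀ q T) hc.le (R + 1) ?_).trans
    (ENNReal.ofReal_le_ofReal (mul_le_mul_of_nonneg_left (by linarith) hσ0))
  intro m hm B F n hB hF ν hν hgrid _ u hu
  refine (hdecay B _ _ u v (hgrid.isAveragingRun (fun e he => (hF e).1 he) u hu)
    (fun x hx => Pi.single_eq_of_ne hx 1) (fun j => T j * 2 ^ n)
    (fun a b hab => Nat.mul_le_mul_right _ (hTmono hab)) ?_ _ ?_).le
  · rintro j hj e ⟨x, hx, hxR⟩
    have heF₀ : e ∈ F₀ := by
      refine (hF₀ e).2 fun y hy => (hB₀ y).2 ?_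
      rw [mk_otherEnd hx, Sym2.mem_iff] at hy
      rcases hy with rfl | rfl
      · omega
      · have h1 := e.2
        rw [mk_otherEnd hx, SimpleGraph.mem_edgeSet] at h1
        have h2 := hconn.dist_triangle (u := v) (v := x) (w := otherEnd (e : Sym2 V) x)
        rw [SimpleGraph.dist_eq_one_iff_adj.2 h1] at h2
        omega
    have heF : e ∈ F := by
      refine (hF e).2 fun y hy => (hB y).2 ?_
      have := (hB₀ y).1 ((hF₀ e).1 heF₀ y hy)
      omega
    have hTt : ∀ i ≤ q, timeGrid t n (T i * 2 ^ n) = T i := by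
      intro i hi
      rw [timeGrid_mul, min_eq_left]
      exact le_trans (by exact_mod_cast hTmono hi) ht
    rw [hgrid.sum_gridExtent heF (Nat.mul_le_mul_right _ (hTmono (Nat.le_succ j))),
      hTt j hj.le, hTt (j + 1) hj]
    exact hν j hj e heF₀
  · refine Nat.mul_le_mul_right _ ?_
    exact_mod_cast ht.trans (Nat.le_ceil t)

end Variance

theorem theorem1 {V Ω : Type*} [MeasurableSpace Ω] (P : Measure Ω) [IsProbabilityMeasure P]
    (G : SimpleGraph V) [Infinite V] [G.LocallyFinite] (hconn : G.Connected)
    (D : ℕ) (hdeg : ∀ v, G.degree v ≤ D)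
    (lam : ℝ≥0) (hlam : 0 < lam)
    (N : G.edgeSet → ℝ≥0 → Ω → ℕ) (M : G.edgeSet → ℕ → Ω → ℝ) (η : ℝ≥0 → V → Ω → ℝ)
    (hη : IsAveragingProcess G lam N M η P)
    (hM : ∀ e, ∀ᵐ ω ∂P, ¬ Summable fun k => M e k ω)
    (hindep : iIndepFun (fun v => η 0 v) P)
    (hident : ∀ u v, IdentDistrib (η 0 u) (η 0 v) P P)
    (hL2 : ∀ v, MemLp (η 0 v) 2 P)
    (m₁ : ℝ) (hm₁ : ∀ v, ∫ ω, η 0 v ω ∂P = m₁) :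
    ∀ v, (∀ t, MemLp (η t v) 2 P) ∧
      Tendsto (fun t : ℝ≥0 => eLpNorm (fun ω => η t v ω - m₁) 2 P) atTop (𝓝 0) := by
  have hσ : ∀ u w, ∫ ω, (η 0 u ω - m₁) ^ 2 ∂P = ∫ ω, (η 0 w ω - m₁) ^ 2 ∂P := fun u w =>
    ((hident u w).comp ((measurable_id.sub_const m₁).pow_const 2)).integral_eq
  intro v
  set σ2 := ∫ ω, (η 0 v ω - m₁) ^ 2 ∂P with hσ2
  have hσ0 : 0 ≤ σ2 := integral_nonneg fun ω => sq_nonneg _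
  have hpow : ∀ t, eLpNorm (fun ω => η t v ω - m₁) 2 P =
      (∫⁻ ω, ‖η t v ω - m₁‖ₑ ^ 2 ∂P) ^ (1 / 2 : ℝ) := by
    intro t
    rw [eLpNorm_eq_lintegral_rpow_enorm_toReal (by norm_num) (by norm_num)]
    simp
  constructor
  · intro t
    have hle := hη.lintegral_sub_sq_le hconn hdeg hindep hL2 hm₁ (fun u => hσ u v) v
      (Nat.le_ceil t) MeasurableSet.univ zero_le_one 0 (by
        intro m _ B F n hB hF ν _ hgrid _ u hu
        have hFB : ∀ e ∈ F, ∀ z ∈ (e : Sym2 V), z ∈ B := fun e he => (hF e).1 he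
        have hvB : v ∈ B := (hB v).2 (by simp)
        exact (Finset.single_le_sum (f := fun u => gridRun F
          (gridExtent F (timeGrid t n) ν.1 ν.2) (Pi.single u 1) (⌈t⌉₊ * 2 ^ n) v)
          (fun w hw => (hgrid.isAveragingRun hFB w hw).nonneg _ v) hu).trans_eq
          (sum_gridRun_single hFB _ _ hvB))
    have hsub : MemLp (fun ω => η t v ω - m₁) 2 P := by
      refine ⟨((hη.measurable_value t v).sub_const m₁).aestronglyMeasurable, ?_⟩
      rw [hpow]
      exact ENNReal.rpow_lt_top_of_nonneg (by norm_num) (hle.trans_lt ENNReal.ofReal_lt_top).ne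
    have hadd := hsub.add (memLp_const m₁)
    refine (memLp_congr_ae (Eventually.of_forall fun ω => ?_)).1 hadd
    simp
  · have hlim : Tendsto (fun t : ℝ≥0 => ∫⁻ ω, ‖η t v ω - m₁‖ₑ ^ 2 ∂P) atTop (𝓝 0) := by
      refine ENNReal.tendsto_nhds_zero.2 fun ε hε => ?_
      obtain ⟨δ, hδ0, hδε⟩ := ENNReal.lt_iff_exists_nnreal_btwn.1 hε
      have hδ : (0 : ℝ) < δ := by exact_mod_cast hδ0
      have hc : (0 : ℝ) < δ / (2 * (σ2 + 1)) := by positivity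
      filter_upwards [hη.eventually_lintegral_sub_sq_le hlam hM hconn hdeg hindep hL2 hm₁
        (fun u => hσ u v) v hc] with t ht
      refine ht.trans (le_trans ?_ hδε.le)
      rw [← ENNReal.ofReal_coe_nnreal]
      apply ENNReal.ofReal_le_ofReal
      have heq : σ2 * (2 * (δ / (2 * (σ2 + 1)))) = σ2 * δ / (σ2 + 1) := by field_simp
      rw [heq, div_le_iff₀ (by positivity)]
      nlinarith
    simp only [hpow]
    have hroot := (ENNReal.continuous_rpow_const (y := 1 / 2)).tendsto 0
    rw [ENNReal.zero_rpow_of_pos (by norm_num)] at hroot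
    exact hroot.comp hlim
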